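/- Let $d\ge 1$, let $\Omega\subseteq\mathbb R^d$ be open and bounded, and let $M_1,\dots,M_N$ be symmetric positive definite real $d\times d$ matrices. Let $q_1,\dots,q_N\ge 0$ with $\sum_j q_j=|\Omega|$, let $\mu_1,\dots,\mu_m>0$ and $f_1,\dots,f_m\in H^{-1}(\Omega)=(H^1_0(\Omega))'$. Let $K=\{\vartheta\in[0,1]^N:\sum_j\vartheta_j=1\}$. With $\lambda_{\min},\lambda_{\max}$ denoting the smallest and largest eigenvalue, put for $\vartheta\in K$ $$\frac1{\lambda_-(\vartheta)}=\sum_{j=1}^N\frac{\vartheta_j}{\lambda_{\min}(M_j)},\qquad \lambda_+(\vartheta)=\sum_{j=1}^N\vartheta_j\,\lambda_{\max}(M_j).$$ Let $$\mathcal T=\Bigl\{\theta\in L^\infty(\Omega;K):\int_\Omega\theta_j\,dx=q_j,\ j=1,\dots,N\Bigr\},$$ $$\mathcal B=\bigl\{(\theta,A):\theta\in\mathcal T,\ A\in L^\infty(\Omega;\mathrm{Sym}_d),\ \lambda_-(\theta)I\le A\le\lambda_+(\theta)I\text{ a.e. on }\Omega\bigr\}.$$ For every $(\theta,A)\in\mathcal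 B$ and every $i$ the problem $-\operatorname{div}(A\nabla u_i)=f_i$, $u_i\in H^1_0(\Omega)$, has a unique weak solution $u_i$. Put $J(\theta,A)=\sum_{i=1}^m\mu_i\langle f_i,u_i\rangle$ and, for $\theta\in\mathcal T$, $I(\theta)=J(\theta,\lambda_-(\theta)I)$. Let $$\mathcal S=\{\sigma\in L^2(\Omega;\mathbb R^d)^m:-\operatorname{div}\sigma_i=f_i,\ i=1,\dots,m\},\qquad H(\theta,\sigma)=\sum_{i=1}^m\mu_i\int_\Omega\frac{|\sigma_i|^2}{\lambda_-(\theta)}\,dx .$$ A saddle point of $H$ is a pair $(\theta^*,\sigma^*)\in\mathcal T\times\mathcal S$ such that $H(\theta,\sigma^*)\le H(\theta^*,\sigma^*)\le H(\theta^*,\sigma)$ for all $\theta\in\mathcal T$, $\sigma\in\mathcal S$. Then the set of saddle points of $H$ is nonempty and of the form $\mathcal T^*\times\{\sigma^*\}$, with a single $\sigma^*\in\mathcal S$, and $H$ has the same value $H^*$ at all of them. Moreover: 1. For every $(\theta,A)\in\mathcal B$, with $u_i$ as above and $\sigma_i=A\nabla u_i$, $$J(\theta,A)=\sum_{i=1}^m\mu_i\int_\Omega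 A^{-1}\sigma_i\cdot\sigma_i\,dx\le\sum_{i=1}^m\mu_i\int_\Omega A^{-1}\sigma_i^*\cdot\sigma_i^*\,dx\le H(\theta,\sigma^*)\le H^*,$$ and this bound is sharp: $\sup_{\mathcal B}J=H^*$. 2. For every $\theta^*\in\mathcal T^*$, the pair $(\theta^*,\lambda_-(\theta^*)I)$ belongs to $\mathcal B$ and maximizes $J$ over $\mathcal B$, and $J(\theta^*,\lambda_-(\theta^*)I)=H^*$. 3. For every $\theta^*\in\mathcal T^*$, a pair $(\theta^*,A)\in\mathcal B$ maximizes $J$ over $\mathcal B$ if and only if $A^{-1}\sigma_i^*=\frac1{\lambda_-(\theta^*)}\sigma_i^*$ a.e. on $\Omega$ for $i=1,\dots,m$. 4. Conversely, if $(\theta,A)\in\mathcal B$ maximizes $J$ over $\mathcal B$, then $\theta$ maximizes $I$ over $\mathcal T$, and $A^{-1}\sigma_i^*=\frac1{\lambda_-(\theta)}\sigma_i^*$ a.e. on $\Omega$ for $i=1,\dots,m$. -/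

import Mathlib

open MeasureTheory
open scoped ContDiff ENNReal

/-- `ℝᵈ` with the Euclidean norm. -/
abbrev Eucl (d : ℕ) : Type := EuclideanSpace ℝ (Fin d)

noncomputable section

/-- `L²(Ω)`. -/
abbrev L2Scalar {d : ℕ} (Ω : Set (Eucl d)) : Type := Lp ℝ 2 (volume.restrict Ω)

/-- `L²(Ω; ℝᵈ)`. -/
abbrev L2Vector {d : ℕ} (Ω : Set (Eucl d)) : Type := Lp (Eucl d) 2 (volume.restrict Ω)

/-- `L²(Ω) × L²(Ω; ℝᵈ)` with its Hilbert norm; `u ↦ (u, ∇u)` embeds `H¹(Ω)` in it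
isometrically. -/
abbrev L2Pair {d : ℕ} (Ω : Set (Eucl d)) : Type := WithLp 2 (L2Scalar Ω × L2Vector Ω)

/-- The pairs `(φ, ∇φ)` with `φ ∈ C_c^∞(Ω)`. -/
def testPairs {d : ℕ} (Ω : Set (Eucl d)) : Submodule ℝ (L2Pair Ω) where
  carrier := {w | ∃ φ : Eucl d → ℝ, ContDiff ℝ ∞ φ ∧ HasCompactSupport φ ∧ tsupport φ ⊆ Ω ∧
    w.fst =ᵐ[volume.restrict Ω] φ ∧ w.snd =ᵐ[volume.restrict Ω] gradient φ}
  zero_mem' := by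
    refine ⟨0, contDiff_const, HasCompactSupport.zero, ?_, Lp.coeFn_zero _ _ _, ?_⟩
    · simp [tsupport]
    · filter_upwards [Lp.coeFn_zero (Eucl d) 2 (volume.restrict Ω)] with x hx
      have h0 : gradient (0 : Eucl d → ℝ) x = 0 := by simp [gradient]
      rw [h0]
      exact hx
  add_mem' := by
    rintro a b ⟨φ, hφ, hφc, hφΩ, h1, h2⟩ ⟨χ, hχ, hχc, hχΩ, h3, h4⟩
    refine ⟨φ + χ, hφ.add hχ, hφc.add hχc, ?_, ?_, ?_⟩
    · exact (tsupport_add φ χ).trans (Set.union_subset hφΩ hχΩ)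
    · exact (Lp.coeFn_add a.fst b.fst).trans (h1.add h3)
    · filter_upwards [Lp.coeFn_add a.snd b.snd, h2, h4] with x hx hx2 hx4
      have hg : gradient (φ + χ) x = gradient φ x + gradient χ x := by
        simp only [gradient]
        rw [fderiv_add (hφ.differentiable (by simp) x) (hχ.differentiable (by simp) x), map_add]
      rw [hg, ← hx2, ← hx4]
      exact hx
  smul_mem' := by
    rintro c a ⟨φ, hφ, hφc, hφΩ, h1, h2⟩
    refine ⟨c • φ, hφ.const_smul c, hφc.smul_left (f := fun _ => c), ?_, ?_, ?_⟩
    · exact (closure_mono (Function.support_const_smul_subset c φ)).trans hφΩ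
    · exact (Lp.coeFn_smul c a.fst).trans (h1.const_smul c)
    · filter_upwards [Lp.coeFn_smul c a.snd, h2] with x hx hx2
      have hg : gradient (c • φ) x = c • gradient φ x := by
        simp only [gradient]
        rw [fderiv_const_smul (hφ.differentiable (by simp) x), map_smul]
      rw [hg, ← hx2]
      exact hx

/-- `H¹₀(Ω)`, the closure of `C_c^∞(Ω)` in the `H¹` norm. A function `u ∈ H¹₀(Ω)` is
represented by the pair `(u, ∇u)`. -/
def H10 {d : ℕ} (Ω : Set (Eucl d)) : Submodule ℝ (L2Pair Ω) := (testPairs Ω).topologicalClosure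

/-- The weak gradient `∇u ∈ L²(Ω; ℝᵈ)` of `u ∈ H¹₀(Ω)`. -/
def weakGrad {d : ℕ} {Ω : Set (Eucl d)} (u : H10 Ω) : L2Vector Ω := (u : L2Pair Ω).snd

/-- `H⁻¹(Ω)`, the topological dual of `H¹₀(Ω)`. -/
abbrev Hneg1 {d : ℕ} (Ω : Set (Eucl d)) : Type := H10 Ω →L[ℝ] ℝ

/-- `u ∈ H¹₀(Ω)` is a weak solution of `-div (A ∇u) = f`. -/
def IsState {d : ℕ} {Ω : Set (Eucl d)} (A : Eucl d → Matrix (Fin d) (Fin d) ℝ) (f : Hneg1 Ω)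
    (u : H10 Ω) : Prop :=
  ∀ v : H10 Ω, ∫ x in Ω, inner ℝ ((A x).toEuclideanLin (weakGrad u x)) (weakGrad v x) = f v

open Classical in
/-- The weak solution `u ∈ H¹₀(Ω)` of `-div (A ∇u) = f` (and `0` if there is none). -/
def state {d : ℕ} {Ω : Set (Eucl d)} (A : Eucl d → Matrix (Fin d) (Fin d) ℝ) (f : Hneg1 Ω) :
    H10 Ω :=
  if h : ∃ u : H10 Ω, IsState A f u then h.choose else 0

/-- Smallest eigenvalue of a symmetric matrix. -/
def minEig {d : ℕ} (M : Matrix (Fin d) (Fin d) ℝ) : ℝ := sInf (spectrum ℝ M)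

/-- Largest eigenvalue of a symmetric matrix. -/
def maxEig {d : ℕ} (M : Matrix (Fin d) (Fin d) ℝ) : ℝ := sSup (spectrum ℝ M)

/-- The lower bound `λ₋(θ)`, the harmonic mean of the smallest eigenvalues. -/
def lamMinus {d N : ℕ} (M : Fin N → Matrix (Fin d) (Fin d) ℝ) (θ : Fin N → ℝ) : ℝ :=
  (∑ j, θ j / minEig (M j))⁻¹

/-- The upper bound `λ₊(θ)`, the arithmetic mean of the largest eigenvalues. -/
def lamPlus {d N : ℕ} (M : Fin N → Matrix (Fin d) (Fin d) ℝ) (θ : Fin N → ℝ) : ℝ :=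
  ∑ j, θ j * maxEig (M j)

/-- The set `K` of local proportions. -/
def propSimplex (N : ℕ) : Set (Fin N → ℝ) := {t | (∀ j, t j ∈ Set.Icc (0 : ℝ) 1) ∧ ∑ j, t j = 1}

/-- The set `𝒯` of fields `θ ∈ L^∞(Ω; K)` with `∫_Ω θ_j = q_j`. -/
def admT {d N : ℕ} (Ω : Set (Eucl d)) (q : Fin N → ℝ) : Set (Eucl d → Fin N → ℝ) :=
  {θ | MemLp θ ∞ (volume.restrict Ω) ∧ (∀ᵐ x ∂volume.restrict Ω, θ x ∈ propSimplex N) ∧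
    ∀ j, ∫ x in Ω, θ x j = q j}

/-- The set `ℬ` of pairs `(θ, A) ∈ L^∞(Ω; K × Sym_d)` with `∫_Ω θ_j = q_j` and
`λ₋(θ) I ≤ A ≤ λ₊(θ) I` a.e. on `Ω`. -/
def admB {d N : ℕ} (Ω : Set (Eucl d)) (M : Fin N → Matrix (Fin d) (Fin d) ℝ) (q : Fin N → ℝ) :
    Set ((Eucl d → Fin N → ℝ) × (Eucl d → Matrix (Fin d) (Fin d) ℝ)) :=
  {p | p.1 ∈ admT Ω q ∧ (∀ k l, MemLp (fun x => p.2 x k l) ∞ (volume.restrict Ω)) ∧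
    (∀ᵐ x ∂volume.restrict Ω, (p.2 x).IsSymm) ∧
    ∀ᵐ x ∂volume.restrict Ω,
      (p.2 x - lamMinus M (p.1 x) • (1 : Matrix (Fin d) (Fin d) ℝ)).PosSemidef ∧
      (lamPlus M (p.1 x) • (1 : Matrix (Fin d) (Fin d) ℝ) - p.2 x).PosSemidef}

/-- `J(θ, A) = ∑ μ_i ⟨f_i, u_i⟩`, where `u_i` solves `-div (A ∇u_i) = f_i`. -/
def funJ {d N m : ℕ} {Ω : Set (Eucl d)} (μ : Fin m → ℝ) (f : Fin m → Hneg1 Ω)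
    (p : (Eucl d → Fin N → ℝ) × (Eucl d → Matrix (Fin d) (Fin d) ℝ)) : ℝ :=
  ∑ i, μ i * f i (state p.2 (f i))

/-- The isotropic matrix field `λ₋(θ) I`. -/
def isoField {d N : ℕ} (M : Fin N → Matrix (Fin d) (Fin d) ℝ) (θ : Eucl d → Fin N → ℝ) :
    Eucl d → Matrix (Fin d) (Fin d) ℝ :=
  fun x => lamMinus M (θ x) • (1 : Matrix (Fin d) (Fin d) ℝ)

/-- `I(θ) = J(θ, λ₋(θ) I)`. -/
def funI {d N m : ℕ} {Ω : Set (Eucl d)} (M : Fin N → Matrix (Fin d) (Fin d) ℝ) (μ : Fin m → ℝ)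
    (f : Fin m → Hneg1 Ω) (θ : Eucl d → Fin N → ℝ) : ℝ :=
  funJ μ f (θ, isoField M θ)

/-- The set `𝒮` of `σ ∈ L²(Ω; ℝᵈ)^m` with `-div σ_i = f_i` in `H⁻¹(Ω)`. -/
def fluxS {d m : ℕ} {Ω : Set (Eucl d)} (f : Fin m → Hneg1 Ω) : Set (Fin m → L2Vector Ω) :=
  {σ | ∀ i, ∀ v : H10 Ω, ∫ x in Ω, inner ℝ (σ i x) (weakGrad v x) = f i v}

/-- `H(θ, σ) = ∑ μ_i ∫_Ω |σ_i|² / λ₋(θ)`. -/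
def funH {d N m : ℕ} {Ω : Set (Eucl d)} (M : Fin N → Matrix (Fin d) (Fin d) ℝ) (μ : Fin m → ℝ)
    (θ : Eucl d → Fin N → ℝ) (σ : Fin m → L2Vector Ω) : ℝ :=
  ∑ i, μ i * ∫ x in Ω, ‖σ i x‖ ^ 2 / lamMinus M (θ x)

/-- `∑ μ_i ∫_Ω A⁻¹ σ_i · σ_i`. -/
def dualEnergy {d m : ℕ} {Ω : Set (Eucl d)} (μ : Fin m → ℝ)
    (A : Eucl d → Matrix (Fin d) (Fin d) ℝ) (σ : Fin m → L2Vector Ω) : ℝ :=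
  ∑ i, μ i * ∫ x in Ω, inner ℝ ((A x)⁻¹.toEuclideanLin (σ i x)) (σ i x)

/-- `(θ, σ)` is a saddle point of `H` on `𝒯 × 𝒮` (maximum in `θ`, minimum in `σ`). -/
def IsSaddle {d N m : ℕ} {Ω : Set (Eucl d)} (M : Fin N → Matrix (Fin d) (Fin d) ℝ)
    (q : Fin N → ℝ) (μ : Fin m → ℝ) (f : Fin m → Hneg1 Ω)
    (θ : Eucl d → Fin N → ℝ) (σ : Fin m → L2Vector Ω) : Prop :=
  θ ∈ admT Ω q ∧ σ ∈ fluxS f ∧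
    (∀ θ' ∈ admT Ω q, funH M μ θ' σ ≤ funH M μ θ σ) ∧
    ∀ σ' ∈ fluxS f, funH M μ θ σ ≤ funH M μ θ σ'

/-- The set `𝒯*` of first components of saddle points of `H`. -/
def saddleT {d N m : ℕ} {Ω : Set (Eucl d)} (M : Fin N → Matrix (Fin d) (Fin d) ℝ)
    (q : Fin N → ℝ) (μ : Fin m → ℝ) (f : Fin m → Hneg1 Ω) : Set (Eucl d → Fin N → ℝ) :=
  {θ | ∃ σ, IsSaddle M q μ f θ σ}

/-- The optimality condition `A⁻¹ σ_i = σ_i / λ₋(θ)` a.e. on `Ω`, `i = 1, …, m`. -/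
def OptCond {d N m : ℕ} {Ω : Set (Eucl d)} (M : Fin N → Matrix (Fin d) (Fin d) ℝ)
    (θ : Eucl d → Fin N → ℝ) (A : Eucl d → Matrix (Fin d) (Fin d) ℝ)
    (σ : Fin m → L2Vector Ω) : Prop :=
  ∀ i, ∀ᵐ x ∂volume.restrict Ω,
    (A x)⁻¹.toEuclideanLin (σ i x) = (1 / lamMinus M (θ x)) • σ i x

end

/-! The argument rests on the dual energy principle. For a fixed admissible `A` the flux `τ = A∇u`
of the states satisfies E_A(σ) = J + E_A(σ - τ) for every admissible flux σ, where E_A is the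
weighted dual energy (`inner_symm_apply_eq_add`, `exists_flux`). So J is the minimum of E_A over the
admissible fluxes, attained only at τ. Solvability of the state equations is Lax–Milgram with
Poincaré's inequality.

Since `A ≥ λ₋ I` gives `A⁻¹ ≤ λ₋⁻¹ I`, E_A is at most `H(θ, ·)`, which is itself the dual energy of
the isotropic field. Evaluating at the flux of a saddle point gives the chain of bounds, and the
isotropic field over a saddle proportion attains the last term. The inequality for inverses is
proved with its defect (`inner_inv_add_le`), so equality yields the optimality condition;
conversely, that condition makes the two fields share their states (`state_eq_of_inv_flux_eq`).

A saddle point exists because `1/λ₋` is linear in θ, so H is affine in θ, while it is strongly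
convex in σ. The minimum over σ is concave in θ, and its supremum is attained by nested closed
convex sets in `L²` (`exists_mem_admT_forall_le_funH`). Moving slightly from the maximizer towards a
competitor and using stability of the minimizers gives the saddle inequalities
(`exists_saddle_of_isMax_min`). The flux is unique by strong convexity and exchange of components
between saddle points. -/

/-! ### Hilbert space and minimax lemmas -/

/-- A coercive bounded operator on a real Hilbert space is invertible. -/
theorem exists_continuousLinearEquiv_of_coercive {V : Type*} [NormedAddCommGroup V]
    [InnerProductSpace ℝ V] [CompleteSpace V] (T : V →L[ℝ] V) {α : ℝ} (hα : 0 < α)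
    (h : ∀ v, α * ‖v‖ ^ 2 ≤ inner ℝ (T v) v) : ∃ e : V ≃L[ℝ] V, ∀ v, e v = T v := by
  let B : V →L[ℝ] V →L[ℝ] ℝ := (innerSL ℝ).comp T
  have hB : IsCoercive B := ⟨α, hα, fun v => by
    have := h v
    simp only [B, ContinuousLinearMap.comp_apply, innerSL_apply_apply]
    linarith⟩
  exact ⟨hB.continuousLinearEquivOfBilin, fun v =>
    (hB.unique_continuousLinearEquivOfBilin fun w => rfl).symm⟩

/-- Unique solvability of `⟪T (G u), G v⟫ = f v` for coercive `T` and `G` bounded below. -/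
theorem existsUnique_inner_comp_eq {V W : Type*} [NormedAddCommGroup V]
    [InnerProductSpace ℝ V] [NormedAddCommGroup W] [InnerProductSpace ℝ W]
    [CompleteSpace W] (G : W →L[ℝ] V) {C : ℝ} (hG : ∀ w, ‖w‖ ≤ C * ‖G w‖)
    (T : V →L[ℝ] V) {α : ℝ} (hα : 0 < α) (hT : ∀ v, α * ‖v‖ ^ 2 ≤ inner ℝ (T v) v)
    (f : W →L[ℝ] ℝ) : ∃! u : W, ∀ v, inner ℝ (T (G u)) (G v) = f v := by
  let R : W →L[ℝ] W →L[ℝ] ℝ :=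
    (ContinuousLinearMap.compL ℝ W V ℝ |>.flip G).comp ((innerSL ℝ).comp (T.comp G))
  have hR : ∀ u v, R u v = inner ℝ (T (G u)) (G v) := fun u v => rfl
  have hc : IsCoercive R := by
    -- The sign of `C` is unknown, and `|C| + 1` is a positive constant that serves as well.
    refine ⟨α / (|C| + 1) ^ 2, by positivity, fun u => ?_⟩
    rw [hR]
    refine le_trans ?_ (hT (G u))
    have h1 : ‖u‖ ≤ (|C| + 1) * ‖G u‖ := (hG u).trans (by
      gcongr
      exact (le_abs_self C).trans (by linarith))
    have h2 : ‖u‖ ^ 2 ≤ (|C| + 1) ^ 2 * ‖G u‖ ^ 2 := by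
      rw [← mul_pow]
      gcongr
    rw [mul_assoc, ← sq, div_mul_eq_mul_div, div_le_iff₀ (by positivity)]
    nlinarith
  let e := hc.continuousLinearEquivOfBilin
  obtain ⟨g, hg⟩ := (InnerProductSpace.toDual ℝ W).surjective f
  have hg' : ∀ v, inner ℝ g v = f v := fun v => by
    rw [← hg, InnerProductSpace.toDual_apply_apply]
  refine ⟨e.symm g, fun v => ?_, fun u hu => ?_⟩
  · rw [← hR, ← hc.continuousLinearEquivOfBilin_apply, ← hg']
    exact congrArg (inner ℝ · v) (e.apply_symm_apply g)
  · apply e.injective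
    rw [e.apply_symm_apply]
    refine ext_inner_right ℝ fun v => ?_
    rw [hg', ← hu v, ← hR]
    exact hc.continuousLinearEquivOfBilin_apply u v

/-- The dual energy splits orthogonally around its minimizer `T (G u)`. -/
theorem inner_symm_apply_eq_add {V W : Type*} [NormedAddCommGroup V]
    [InnerProductSpace ℝ V] [NormedAddCommGroup W] [InnerProductSpace ℝ W] (G : W →L[ℝ] V)
    (T : V ≃L[ℝ] V) (hT : ∀ v w, inner ℝ (T v) w = inner ℝ v (T w))
    (f : W →L[ℝ] ℝ) {u : W} (hu : ∀ v, inner ℝ (T (G u)) (G v) = f v) {σ : V}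
    (hσ : ∀ v, inner ℝ σ (G v) = f v) :
    inner ℝ (T.symm σ) σ = f u + inner ℝ (T.symm (σ - T (G u))) (σ - T (G u)) := by
  have hs : inner ℝ (T.symm σ) (T (G u)) = f u := by
    rw [← hT, T.apply_symm_apply, hσ]
  have h2 : inner ℝ (G u) σ = f u := by rw [real_inner_comm, hσ]
  have h3 : inner ℝ (G u) (T (G u)) = f u := by rw [real_inner_comm, hu]
  rw [map_sub, T.symm_apply_apply, inner_sub_left, inner_sub_right, inner_sub_right, hs, h2, h3]
  ring

/-- The inverse of a coercive operator is coercive. -/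
theorem exists_mul_norm_sq_le_inner_symm {V : Type*} [NormedAddCommGroup V]
    [InnerProductSpace ℝ V] (T : V ≃L[ℝ] V) {α : ℝ} (hα : 0 < α)
    (h : ∀ v, α * ‖v‖ ^ 2 ≤ inner ℝ (T v) v) :
    ∃ κ > 0, ∀ v, κ * ‖v‖ ^ 2 ≤ inner ℝ (T.symm v) v := by
  set c := ‖(T : V →L[ℝ] V)‖
  have hc : 0 ≤ c := norm_nonneg _
  refine ⟨α / (c + 1) ^ 2, by positivity, fun v => ?_⟩
  have h1 := h (T.symm v)
  rw [T.apply_symm_apply, real_inner_comm] at h1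
  refine le_trans ?_ h1
  have h2 : ‖v‖ ≤ (c + 1) * ‖T.symm v‖ := by
    have := (T : V →L[ℝ] V).le_opNorm (T.symm v)
    simp only [ContinuousLinearEquiv.coe_coe, T.apply_symm_apply] at this
    exact this.trans (by gcongr; simp [c])
  have h3 : ‖v‖ ^ 2 ≤ (c + 1) ^ 2 * ‖T.symm v‖ ^ 2 := by
    rw [← mul_pow]
    gcongr
  rw [div_mul_eq_mul_div, div_le_iff₀ (by positivity)]
  nlinarith

/-- A decreasing sequence of nonempty closed convex sets in a Hilbert space, the first of which
is bounded, has a common point. -/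
theorem nonempty_iInter_of_antitone_convex {V : Type*} [NormedAddCommGroup V]
    [InnerProductSpace ℝ V] [CompleteSpace V] (C : ℕ → Set V) (hanti : Antitone C)
    (hne : ∀ n, (C n).Nonempty) (hcl : ∀ n, IsClosed (C n)) (hconv : ∀ n, Convex ℝ (C n))
    {R : ℝ} (hbdd : ∀ v ∈ C 0, ‖v‖ ≤ R) : (⋂ n, C n).Nonempty := by
  -- The points of least norm in the sets converge to a common point: their norms increase and stay
  -- bounded, and the variational inequality of the projection turns this into a Cauchy estimate.
  have key : ∀ n, ∃ p ∈ C n, ∀ w ∈ C n, 0 ≤ inner ℝ p (w - p) := by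
    intro n
    obtain ⟨p, hp, hpe⟩ := exists_norm_eq_iInf_of_complete_convex (hne n)
      (hcl n).isComplete (hconv n) 0
    refine ⟨p, hp, fun w hw => ?_⟩
    have := (norm_eq_iInf_iff_real_inner_le_zero (hconv n) hp).1 hpe w hw
    rw [zero_sub, inner_neg_left] at this
    linarith
  choose p hp hpm using key
  have hdist : ∀ n k, n ≤ k → ‖p k - p n‖ ^ 2 ≤ ‖p k‖ ^ 2 - ‖p n‖ ^ 2 := by
    intro n k hnk
    have h1 := hpm n (p k) (hanti hnk (hp k))
    have h2 := norm_add_sq_real (p n) (p k - p n)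
    rw [add_sub_cancel] at h2
    linarith
  have hmono : Monotone fun n => ‖p n‖ ^ 2 := fun n k hnk => by
    have := hdist n k hnk
    have := sq_nonneg ‖p k - p n‖
    simp only
    linarith
  have hbd : BddAbove (Set.range fun n => ‖p n‖ ^ 2) := by
    refine ⟨R ^ 2, ?_⟩
    rintro _ ⟨n, rfl⟩
    have := hbdd _ (hanti (Nat.zero_le n) (hp n))
    simp only
    gcongr
  set L := ⨆ n, ‖p n‖ ^ 2
  have hL := tendsto_atTop_ciSup hmono hbd
  have hcau : CauchySeq p := by
    refine cauchySeq_of_le_tendsto_0 (fun n => 2 * √(L - ‖p n‖ ^ 2)) (fun n k i hn hk => ?_) ?_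
    · have hi : ∀ l, i ≤ l → dist (p l) (p i) ≤ √(L - ‖p i‖ ^ 2) := fun l hl => by
        rw [dist_eq_norm]
        refine Real.le_sqrt_of_sq_le ((hdist i l hl).trans ?_)
        have := le_ciSup hbd l
        linarith
      have := dist_triangle_right (p n) (p k) (p i)
      linarith [hi n hn, hi k hk]
    · have : Filter.Tendsto (fun n => 2 * √(L - ‖p n‖ ^ 2)) Filter.atTop
          (nhds (2 * √(L - L))) := ((hL.const_sub L).sqrt).const_mul 2
      simpa using this
  obtain ⟨a, ha⟩ := cauchySeq_tendsto_of_complete hcau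
  refine ⟨a, Set.mem_iInter.2 fun n => (hcl n).mem_of_tendsto ha ?_⟩
  filter_upwards [Filter.eventually_ge_atTop n] with k hk using hanti hk (hp k)

/-- For a function that is affine in the first variable and has strongly stable minimizers in the
second one, a maximizer of the minimum value is the first component of a saddle point. -/
theorem exists_saddle_of_isMax_min {X Y : Type*} [AddCommGroup X] [Module ℝ X] [MetricSpace Y]
    {T : Set X} {S : Set Y} {H : X → Y → ℝ} (hT : Convex ℝ T)
    (haff : ∀ a ∈ T, ∀ b ∈ T, ∀ t ∈ Set.Icc (0 : ℝ) 1, ∀ s,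
      H ((1 - t) • a + t • b) s = (1 - t) * H a s + t * H b s)
    (hnn : ∀ a ∈ T, ∀ s, 0 ≤ H a s) (hcont : ∀ a ∈ T, Continuous (H a)) (φ : X → Y)
    (hφ : ∀ a ∈ T, φ a ∈ S)
    (hmin : ∀ a ∈ T, ∃ κ > 0, ∀ s ∈ S, H a (φ a) + κ * dist s (φ a) ^ 2 ≤ H a s)
    {a : X} (ha : a ∈ T) (hmax : ∀ b ∈ T, H b (φ b) ≤ H a (φ a)) :
    (∀ b ∈ T, H b (φ a) ≤ H a (φ a)) ∧ ∀ s ∈ S, H a (φ a) ≤ H a s := by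
  obtain ⟨κ, hκ, hκm⟩ := hmin a ha
  refine ⟨fun b hb => ?_, fun s hs => ?_⟩
  -- The shift by 2 keeps `t n ≤ 1 / 2`, so the weight on `a` never falls below one half.
  · let t : ℕ → ℝ := fun n => 1 / ((n : ℝ) + 2)
    have ht0 : ∀ n, 0 < t n := fun n => by positivity
    have ht1 : ∀ n, t n ≤ 1 / 2 := fun n => by
      apply one_div_le_one_div_of_le <;> [norm_num; (have := n.cast_nonneg (α := ℝ); linarith)]
    let c : ℕ → X := fun n => (1 - t n) • a + t n • b
    have hc : ∀ n, c n ∈ T := fun n =>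
      hT ha hb (by linarith [ht1 n]) (ht0 n).le (by ring)
    have hval : ∀ n, (1 - t n) * H a (φ (c n)) + t n * H b (φ (c n)) ≤ H a (φ a) := fun n => by
      rw [← haff a ha b hb (t n) ⟨(ht0 n).le, by linarith [ht1 n]⟩]
      exact hmax _ (hc n)
    have htt : Filter.Tendsto t Filter.atTop (nhds 0) := by
      have := (tendsto_one_div_add_atTop_nhds_zero_nat (𝕜 := ℝ)).comp (Filter.tendsto_add_atTop_nat 1)
      refine this.congr fun n => ?_
      simp only [t, Function.comp, Nat.cast_add, Nat.cast_one]
      ring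
    -- Dropping the nonnegative term of `b` in `hval` leaves `(1 - t) (H a (φ a) + κ dist²) ≤ H a (φ
    -- a)`, so the minimizers at `c n` converge to the one at `a`.
    have hle : ∀ n, dist (φ (c n)) (φ a) ≤ √(2 * H a (φ a) / κ * t n) := fun n => by
      refine Real.le_sqrt_of_sq_le ?_
      rw [div_mul_eq_mul_div, le_div_iff₀ hκ]
      have h1 := hκm _ (hφ _ (hc n))
      have h2 := mul_nonneg (ht0 n).le (hnn b hb (φ (c n)))
      have h3 := hval n
      have h4 : (1 - t n) * (H a (φ a) + κ * dist (φ (c n)) (φ a) ^ 2) ≤ H a (φ a) := by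
        have := mul_le_mul_of_nonneg_left h1 (by linarith [ht1 n] : 0 ≤ 1 - t n)
        linarith
      have h5 : (1 / 2) * (κ * dist (φ (c n)) (φ a) ^ 2) ≤
          (1 - t n) * (κ * dist (φ (c n)) (φ a) ^ 2) := by
        gcongr
        linarith [ht1 n]
      nlinarith
    have hlim : Filter.Tendsto (fun n => φ (c n)) Filter.atTop (nhds (φ a)) := by
      rw [tendsto_iff_dist_tendsto_zero]
      refine squeeze_zero (fun _ => dist_nonneg) hle ?_
      have := (htt.const_mul (2 * H a (φ a) / κ)).sqrt
      simpa using this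
    -- Since `φ a` minimizes `H a`, the `a`-part of `hval` is at least `(1 - t) H a (φ a)`;
    -- cancelling it and dividing by `t` bounds `H b` at `φ (c n)`.
    refine le_of_tendsto (((hcont b hb).tendsto _).comp hlim) (Filter.Eventually.of_forall fun n => ?_)
    have h1 := hκm _ (hφ _ (hc n))
    have h2 : H a (φ a) ≤ H a (φ (c n)) := le_trans (by
      have : 0 ≤ κ * dist (φ (c n)) (φ a) ^ 2 := by positivity
      linarith) h1
    have h3 := mul_le_mul_of_nonneg_left h2 (by linarith [ht1 n] : 0 ≤ 1 - t n)
    have h4 : t n * H b (φ (c n)) ≤ t n * H a (φ a) := by linarith [hval n]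
    exact le_of_mul_le_mul_left h4 (ht0 n)
  · have := hκm s hs
    have : 0 ≤ κ * dist s (φ a) ^ 2 := by positivity
    linarith

/-! ### Poincaré's inequality and the gradient operator -/

theorem continuous_gradient {E : Type*} [NormedAddCommGroup E] [InnerProductSpace ℝ E]
    [CompleteSpace E] {φ : E → ℝ} (hφ : ContDiff ℝ ∞ φ) : Continuous (gradient φ) := by
  unfold gradient
  exact (InnerProductSpace.toDual ℝ E).symm.continuous.comp (hφ.continuous_fderiv (by simp))

theorem support_gradient_subset {E : Type*} [NormedAddCommGroup E] [InnerProductSpace ℝ E]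
    [CompleteSpace E] (φ : E → ℝ) : Function.support (gradient φ) ⊆ tsupport φ := by
  intro x hx
  refine support_fderiv_subset ℝ (fun h => hx ?_)
  rw [gradient, h, map_zero]

/-- Poincaré's inequality for test functions supported in a ball. -/
theorem integral_sq_le_integral_norm_gradient_sq {E : Type*} [NormedAddCommGroup E]
    [InnerProductSpace ℝ E] [FiniteDimensional ℝ E] [MeasurableSpace E] [BorelSpace E]
    {φ : E → ℝ} (hφ : ContDiff ℝ ∞ φ)
    (hc : HasCompactSupport φ) {R : ℝ} (hR : ∀ x ∈ tsupport φ, ‖x‖ ≤ R) {e : E} (he : ‖e‖ = 1) :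
    ∫ x, φ x ^ 2 ≤ 4 * R ^ 2 * ∫ x, ‖gradient φ x‖ ^ 2 := by
  have hφd := hφ.differentiable (by simp)
  have hφ1 : ContDiff ℝ 1 φ := hφ.of_le (by exact_mod_cast le_top)
  have hfc : Continuous (fun x => fderiv ℝ φ x e) := by
    have := hφ.continuous_fderiv (by simp)
    fun_prop
  have hcont := hφ.continuous
  have hsq : Integrable (fun x => φ x ^ 2) :=
    (hcont.pow 2).integrable_of_hasCompactSupport (by
      simpa [pow_two] using hc.mul_right (f' := φ))
  have hG : Integrable (fun x => ‖gradient φ x‖ ^ 2) := by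
    refine (((continuous_gradient hφ).norm).pow 2).integrable_of_hasCompactSupport ?_
    refine hc.mono' fun x hx => support_gradient_subset φ fun h => hx ?_
    simp [h]
  have hlin : ∀ x, fderiv ℝ (fun y => inner ℝ e y) x e = 1 := fun x => by
    have : HasFDerivAt (fun y : E => (inner ℝ e y : ℝ)) (innerSL ℝ e) x := (innerSL ℝ e).hasFDerivAt
    rw [this.fderiv]
    simp [he]
  have hsqd : ∀ x, fderiv ℝ (fun y => φ y ^ 2) x e = 2 * φ x * fderiv ℝ φ x e := fun x => by
    rw [((hφd x).hasFDerivAt.pow 2).fderiv]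
    simp
  -- The function `⟪e, x⟫` has derivative 1 along `e`; integrating by parts against it expresses the
  -- integral of `φ²` through `φ ∂ₑφ`, with a factor bounded by `R` on the support.
  have hpart := integral_mul_fderiv_eq_neg_fderiv_mul_of_integrable (μ := (volume : Measure E))
    (f := fun y => (inner ℝ e y : ℝ)) (g := fun y => φ y ^ 2) (v := e)
    (by simpa only [hlin, one_mul] using hsq)
    (by
      simp only [hsqd]
      refine Continuous.integrable_of_hasCompactSupport (by fun_prop) ?_
      refine hc.mono fun x hx h => hx ?_
      simp [show φ x = 0 from h])
    (by
      refine Continuous.integrable_of_hasCompactSupport (by fun_prop) ?_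
      refine hc.mono fun x hx h => hx ?_
      simp [show φ x = 0 from h])
    (fun x _ => ((innerSL ℝ e).differentiableAt : DifferentiableAt ℝ (innerSL ℝ e) x))
    (fun x _ => (hφd x).pow 2)
  simp only [hlin, hsqd, one_mul] at hpart
  have hbound : ∫ x, φ x ^ 2 ≤ ∫ x, (φ x ^ 2 / 2 + 2 * R ^ 2 * ‖gradient φ x‖ ^ 2) := by
    rw [← neg_eq_iff_eq_neg.2 hpart, ← integral_neg]
    refine integral_mono ?_ ((hsq.div_const 2).add (hG.const_mul _)) fun x => ?_
    · refine Continuous.integrable_of_hasCompactSupport (by fun_prop) ?_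
      refine hc.mono fun x hx h => hx ?_
      simp [show φ x = 0 from h]
    · simp only
      by_cases hx : x ∈ tsupport φ
      · have h1 : |(inner ℝ e x : ℝ)| ≤ R := by
          have := abs_real_inner_le_norm e x
          rw [he, one_mul] at this
          exact this.trans (hR x hx)
        have h2 : |fderiv ℝ φ x e| ≤ ‖gradient φ x‖ := by
          rw [← inner_gradient_left]
          have := abs_real_inner_le_norm (gradient φ x) e
          rwa [he, mul_one] at this
        have h3 : |inner ℝ e x * fderiv ℝ φ x e| ≤ R * ‖gradient φ x‖ := by
          rw [abs_mul]
          exact mul_le_mul h1 h2 (abs_nonneg _) ((abs_nonneg _).trans h1)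
        have h4 : (inner ℝ e x * fderiv ℝ φ x e) ^ 2 ≤ (R * ‖gradient φ x‖) ^ 2 := by
          rw [← sq_abs]
          gcongr
        nlinarith [sq_nonneg (φ x + 2 * (inner ℝ e x * fderiv ℝ φ x e))]
      · have : φ x = 0 := image_eq_zero_of_notMem_tsupport hx
        simp only [this]
        have : 0 ≤ R ^ 2 * ‖gradient φ x‖ ^ 2 := by positivity
        simp
        positivity
  rw [integral_add (hsq.div_const 2) (hG.const_mul _), integral_div, integral_const_mul] at hbound
  linarith

theorem norm_sq_eq_integral_norm_sq {α E : Type*} [MeasurableSpace α] {ν : Measure α}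
    [NormedAddCommGroup E] [InnerProductSpace ℝ E] (g : Lp E 2 ν) :
    ‖g‖ ^ 2 = ∫ x, ‖g x‖ ^ 2 ∂ν := by
  rw [← real_inner_self_eq_norm_sq, L2.inner_def]
  simp

/-- Poincaré's inequality on `H¹₀(Ω)`. -/
theorem exists_norm_le_mul_norm_weakGrad {d : ℕ} (hd : 1 ≤ d) {Ω : Set (Eucl d)}
    (hΩb : Bornology.IsBounded Ω) :
    ∃ C : ℝ, ∀ u : H10 Ω, ‖u‖ ≤ C * ‖weakGrad u‖ := by
  obtain ⟨R, hR⟩ := hΩb.exists_norm_le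
  -- For empty `Ω` the bound `R` may be negative.
  let R' := max R 0
  have hfst : ∀ w ∈ H10 Ω, ‖w.fst‖ ≤ 2 * R' * ‖w.snd‖ := by
    intro w hw
    -- The inequality is a closed condition on pairs, so test functions suffice.
    have hcl : IsClosed {w : L2Pair Ω | ‖w.fst‖ ≤ 2 * R' * ‖w.snd‖} := by
      apply isClosed_le <;> fun_prop
    refine closure_minimal ?_ hcl hw
    rintro w ⟨φ, hφ, hφc, hφΩ, h1, h2⟩
    have key := integral_sq_le_integral_norm_gradient_sq hφ hφc (R := R')
      (fun x hx => (hR x (hφΩ hx)).trans (le_max_left _ _))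
      (e := EuclideanSpace.single (⟨0, hd⟩ : Fin d) (1 : ℝ)) (by simp)
    have e1 : ‖w.fst‖ ^ 2 = ∫ x, φ x ^ 2 := by
      rw [norm_sq_eq_integral_norm_sq,
        ← setIntegral_eq_integral_of_forall_compl_eq_zero (s := Ω) (f := fun x => φ x ^ 2)]
      · refine integral_congr_ae ?_
        filter_upwards [h1] with x hx
        simp [hx]
      · intro x hx
        simp [image_eq_zero_of_notMem_tsupport fun h => hx (hφΩ h)]
    have e2 : ‖w.snd‖ ^ 2 = ∫ x, ‖gradient φ x‖ ^ 2 := by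
      rw [norm_sq_eq_integral_norm_sq,
        ← setIntegral_eq_integral_of_forall_compl_eq_zero (s := Ω)
          (f := fun x => ‖gradient φ x‖ ^ 2)]
      · refine integral_congr_ae ?_
        filter_upwards [h2] with x hx
        simp [hx]
      · intro x hx
        have : gradient φ x = 0 := by
          by_contra h
          exact hx (hφΩ (support_gradient_subset φ h))
        simp [this]
    rw [← e1, ← e2] at key
    refine (abs_le_of_sq_le_sq' (b := 2 * R' * ‖w.snd‖) ?_ ?_).2
    · linarith [key]
    · have : 0 ≤ R' := le_max_right _ _
      positivity
  refine ⟨2 * R' + 1, fun u => ?_⟩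
  have h1 := hfst u u.2
  have hR0 : 0 ≤ R' := le_max_right _ _
  have h2 : ‖(u : L2Pair Ω)‖ ^ 2 = ‖(u : L2Pair Ω).fst‖ ^ 2 + ‖(u : L2Pair Ω).snd‖ ^ 2 :=
    WithLp.prod_norm_sq_eq_of_L2 _
  refine abs_le_of_sq_le_sq' ?_ (by positivity) |>.2
  change ‖(u : L2Pair Ω)‖ ^ 2 ≤ ((2 * R' + 1) * ‖(u : L2Pair Ω).snd‖) ^ 2
  rw [h2]
  have h3 : ‖(u : L2Pair Ω).fst‖ ^ 2 ≤ (2 * R' * ‖(u : L2Pair Ω).snd‖) ^ 2 := by gcongr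
  have : 0 ≤ R' * ‖(u : L2Pair Ω).snd‖ ^ 2 := by positivity
  nlinarith

noncomputable section

/-- The gradient `H¹₀(Ω) → L²(Ω; ℝᵈ)` as a bounded operator. -/
def weakGradCLM {d : ℕ} (Ω : Set (Eucl d)) : H10 Ω →L[ℝ] L2Vector Ω :=
  (WithLp.sndL 2 ℝ (L2Scalar Ω) (L2Vector Ω)).comp (H10 Ω).subtypeL

end

instance {d : ℕ} (Ω : Set (Eucl d)) : CompleteSpace (H10 Ω) :=
  (Submodule.isClosed_topologicalClosure _).completeSpace_coe

/-! ### Pointwise estimates for matrices -/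

theorem minEig_pos {d : ℕ} (hd : 1 ≤ d) {M : Matrix (Fin d) (Fin d) ℝ} (hM : M.PosDef) :
    0 < minEig M := by
  have : Nonempty (Fin d) := ⟨⟨0, hd⟩⟩
  have h := hM.1.spectrum_real_eq_range_eigenvalues
  rw [minEig, h]
  obtain ⟨i, hi⟩ := (Set.range_nonempty hM.1.eigenvalues).csInf_mem (Set.finite_range _)
  rw [← hi]
  exact hM.eigenvalues_pos i

theorem minEig_le_maxEig {d : ℕ} (hd : 1 ≤ d) {M : Matrix (Fin d) (Fin d) ℝ}
    (hM : M.PosDef) : minEig M ≤ maxEig M := by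
  have : Nonempty (Fin d) := ⟨⟨0, hd⟩⟩
  have h := hM.1.spectrum_real_eq_range_eigenvalues
  rw [minEig, maxEig, h]
  exact csInf_le_csSup (Set.range_nonempty _) (Set.finite_range _).bddBelow
    (Set.finite_range _).bddAbove

theorem inv_lamMinus {d N : ℕ} (M : Fin N → Matrix (Fin d) (Fin d) ℝ) (t : Fin N → ℝ) :
    (lamMinus M t)⁻¹ = ∑ j, t j / minEig (M j) := by
  rw [lamMinus, inv_inv]

section Simplex

variable {d N : ℕ} {M : Fin N → Matrix (Fin d) (Fin d) ℝ} {t : Fin N → ℝ}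

theorem sum_div_minEig_pos (hm : ∀ j, 0 < minEig (M j)) (ht : t ∈ propSimplex N) :
    0 < ∑ j, t j / minEig (M j) := by
  obtain ⟨j, -, hj⟩ : ∃ j ∈ Finset.univ, (0 : ℝ) < t j :=
    Finset.exists_lt_of_sum_lt (by rw [ht.2]; simp)
  exact Finset.sum_pos' (fun i _ => div_nonneg (ht.1 i).1 (hm i).le)
    ⟨j, Finset.mem_univ _, div_pos hj (hm j)⟩

theorem lamMinus_pos (hm : ∀ j, 0 < minEig (M j)) (ht : t ∈ propSimplex N) :
    0 < lamMinus M t :=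
  inv_pos.2 (sum_div_minEig_pos hm ht)

theorem sum_div_minEig_le (hm : ∀ j, 0 < minEig (M j)) (ht : t ∈ propSimplex N) :
    ∑ j, t j / minEig (M j) ≤ ∑ j, (minEig (M j))⁻¹ := by
  refine Finset.sum_le_sum fun j _ => ?_
  rw [div_eq_mul_inv]
  exact mul_le_of_le_one_left (inv_pos.2 (hm j)).le (ht.1 j).2

/-- This supplies a coercivity constant independent of the point. The summand 1 keeps the constant
positive even for `N = 0`. -/
theorem inv_one_add_sum_le_lamMinus (hm : ∀ j, 0 < minEig (M j)) (ht : t ∈ propSimplex N) :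
    (1 + ∑ j, (minEig (M j))⁻¹)⁻¹ ≤ lamMinus M t := by
  have := sum_div_minEig_le hm ht
  exact inv_anti₀ (sum_div_minEig_pos hm ht) (by linarith)

/-- The harmonic mean of the smallest eigenvalues is at most the arithmetic mean of the
largest ones. -/
theorem lamMinus_le_lamPlus (hm : ∀ j, 0 < minEig (M j))
    (hmM : ∀ j, minEig (M j) ≤ maxEig (M j)) (ht : t ∈ propSimplex N) :
    lamMinus M t ≤ lamPlus M t := by
  have hl := lamMinus_pos hm ht
  set l := lamMinus M t
  -- From `(l - a)² ≥ 0` comes `2l - l²/a ≤ a`. Averaging over the smallest eigenvalues `a` gives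
  -- `2l - l² l⁻¹ = l` on the left.
  have h1 : ∀ j, t j * (2 * l) - l ^ 2 * (t j / minEig (M j)) ≤ t j * maxEig (M j) := by
    intro j
    have hj := hm j
    have h2 : 2 * l - l ^ 2 / minEig (M j) ≤ minEig (M j) := by
      rw [sub_le_iff_le_add, ← sub_le_iff_le_add', le_div_iff₀ hj]
      nlinarith [sq_nonneg (l - minEig (M j))]
    calc _ = t j * (2 * l - l ^ 2 / minEig (M j)) := by ring
      _ ≤ t j * maxEig (M j) := mul_le_mul_of_nonneg_left (h2.trans (hmM j)) (ht.1 j).1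
  have h3 := Finset.sum_le_sum fun j (_ : j ∈ Finset.univ) => h1 j
  rw [Finset.sum_sub_distrib, ← Finset.sum_mul, ← Finset.mul_sum, ht.2, ← inv_lamMinus] at h3
  have h4 : l ^ 2 * l⁻¹ = l := by field_simp
  rw [h4] at h3
  rw [lamPlus]
  linarith

theorem lamPlus_le (hm : ∀ j, 0 < minEig (M j)) (hmM : ∀ j, minEig (M j) ≤ maxEig (M j))
    (ht : t ∈ propSimplex N) : lamPlus M t ≤ ∑ j, maxEig (M j) :=
  Finset.sum_le_sum fun j _ => mul_le_of_le_one_left ((hm j).le.trans (hmM j)) (ht.1 j).2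

end Simplex

section Matrix

variable {n : Type*} [Fintype n] [DecidableEq n] {A : Matrix n n ℝ}

theorem toEuclideanLin_smul_one (l : ℝ) (v : EuclideanSpace ℝ n) :
    (l • (1 : Matrix n n ℝ)).toEuclideanLin v = l • v := by
  simp

theorem inner_toEuclideanLin_ge {l : ℝ} (h : (A - l • (1 : Matrix n n ℝ)).PosSemidef)
    (v : EuclideanSpace ℝ n) : l * ‖v‖ ^ 2 ≤ inner ℝ (A.toEuclideanLin v) v := by
  have h1 := (Matrix.isPositive_toEuclideanLin_iff.2 h).2 v
  rw [map_sub, LinearMap.sub_apply, inner_sub_left, toEuclideanLin_smul_one,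
    real_inner_smul_left, real_inner_self_eq_norm_sq] at h1
  exact sub_nonneg.1 h1

theorem isUnit_of_coercive {l : ℝ} (hl : 0 < l)
    (h : ∀ v : EuclideanSpace ℝ n, l * ‖v‖ ^ 2 ≤ inner ℝ (A.toEuclideanLin v) v) :
    IsUnit A := by
  rw [← Matrix.mulVec_injective_iff_isUnit]
  refine (injective_iff_map_eq_zero (Matrix.mulVecLin A)).2 ?_
  intro v hv
  have h1 := h (WithLp.toLp 2 v)
  have h2 : A.toEuclideanLin (WithLp.toLp 2 v) = 0 := by
    rw [Matrix.toLpLin_apply]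
    simpa using hv
  rw [h2, inner_zero_left] at h1
  have h3 : ‖WithLp.toLp 2 v‖ ^ 2 ≤ 0 := by
    by_contra h
    push Not at h
    linarith [mul_pos hl h]
  have h4 : WithLp.toLp 2 v = 0 := by
    rw [← norm_eq_zero]
    exact pow_eq_zero_iff (two_ne_zero) |>.1 (le_antisymm h3 (sq_nonneg _))
  simpa using h4

theorem toEuclideanLin_inv_apply_apply (hA : IsUnit A) (v : EuclideanSpace ℝ n) :
    (A⁻¹).toEuclideanLin (A.toEuclideanLin v) = v := by
  simp only [Matrix.toLpLin_apply, Matrix.mulVec_mulVec]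
  rw [Matrix.nonsing_inv_mul _ ((Matrix.isUnit_iff_isUnit_det _).1 hA), Matrix.one_mulVec]

theorem toEuclideanLin_apply_inv_apply (hA : IsUnit A) (v : EuclideanSpace ℝ n) :
    A.toEuclideanLin ((A⁻¹).toEuclideanLin v) = v := by
  simp only [Matrix.toLpLin_apply, Matrix.mulVec_mulVec]
  rw [Matrix.mul_nonsing_inv _ ((Matrix.isUnit_iff_isUnit_det _).1 hA), Matrix.one_mulVec]

/-- `A⁻¹ ≤ l⁻¹ I` for `A ≥ l I`, with the defect in the inequality. -/
theorem inner_inv_add_le {l : ℝ} (hl : 0 < l)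
    (h : ∀ v : EuclideanSpace ℝ n, l * ‖v‖ ^ 2 ≤ inner ℝ (A.toEuclideanLin v) v)
    (v : EuclideanSpace ℝ n) :
    inner ℝ ((A⁻¹).toEuclideanLin v) v + ‖v - l • (A⁻¹).toEuclideanLin v‖ ^ 2 / l ≤
      ‖v‖ ^ 2 / l := by
  have h1 := h ((A⁻¹).toEuclideanLin v)
  rw [toEuclideanLin_apply_inv_apply (isUnit_of_coercive hl h), real_inner_comm] at h1
  -- Expand the square with `w = A⁻¹ v`: the lower bound on `A` at `w` reads `l ‖w‖² ≤ ⟪w, v⟫` and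
  -- absorbs the term `l² ‖w‖²`.
  have h2 : ‖v - l • (A⁻¹).toEuclideanLin v‖ ^ 2 ≤
      ‖v‖ ^ 2 - l * inner ℝ ((A⁻¹).toEuclideanLin v) v := by
    rw [norm_sub_sq_real, inner_smul_right, norm_smul, mul_pow, Real.norm_eq_abs, sq_abs,
      real_inner_comm]
    nlinarith
  rw [← sub_nonneg]
  have : ‖v‖ ^ 2 / l - (inner ℝ ((A⁻¹).toEuclideanLin v) v +
      ‖v - l • (A⁻¹).toEuclideanLin v‖ ^ 2 / l) = (‖v‖ ^ 2 - l * inner ℝ ((A⁻¹).toEuclideanLin v) v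
        - ‖v - l • (A⁻¹).toEuclideanLin v‖ ^ 2) / l := by
    field_simp
    ring
  rw [this]
  exact div_nonneg (by linarith) hl.le

theorem toEuclideanLin_inv_smul_one {l : ℝ} (hl : l ≠ 0) (v : EuclideanSpace ℝ n) :
    (l • (1 : Matrix n n ℝ))⁻¹.toEuclideanLin v = l⁻¹ • v := by
  have : (l • (1 : Matrix n n ℝ))⁻¹ = l⁻¹ • 1 := by
    apply Matrix.inv_eq_right_inv
    rw [smul_mul_smul_comm, mul_one, mul_inv_cancel₀ hl, one_smul]
  rw [this, toEuclideanLin_smul_one]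

end Matrix

/-! ### Multiplication operators on `L²` -/

/-- A bounded measurable field of operators acts on `L²`. -/
theorem exists_multiplication_clm {α E : Type*} [MeasurableSpace α] {ν : Measure α}
    [NormedAddCommGroup E] [InnerProductSpace ℝ E] {B : α → E →L[ℝ] E} (hB : MemLp B ∞ ν) :
    ∃ T : Lp E 2 ν →L[ℝ] Lp E 2 ν, ∀ σ, T σ =ᵐ[ν] fun x => B x (σ x) := by
  let b : (E →L[ℝ] E) →L[ℝ] E →L[ℝ] E := ContinuousLinearMap.id ℝ (E →L[ℝ] E)
  refine ⟨b.holderL ν ∞ 2 2 (hB.toLp B), fun σ => ?_⟩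
  refine (b.coeFn_holder (r := 2) (hB.toLp B) σ).trans ?_
  filter_upwards [hB.coeFn_toLp] with x hx
  rw [hx]
  rfl

theorem memLp_toEuclideanCLM {α : Type*} [MeasurableSpace α] {ν : Measure α} {n : Type*}
    [Fintype n] [DecidableEq n] {p : ℝ≥0∞} {A : α → Matrix n n ℝ}
    (hA : ∀ k l, MemLp (fun x => A x k l) p ν) :
    MemLp (fun x => Matrix.toEuclideanCLM (n := n) (𝕜 := ℝ) (A x)) p ν := by
  let L : (n → n → ℝ) →ₗ[ℝ] (EuclideanSpace ℝ n →L[ℝ] EuclideanSpace ℝ n) :=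
    (Matrix.toEuclideanCLM (n := n) (𝕜 := ℝ)).toAlgEquiv.toLinearMap
  exact (LinearMap.toContinuousLinearMap L).comp_memLp' (f := fun x k l => A x k l)
    (MemLp.of_eval fun k => MemLp.of_eval (hA k))

section Field

variable {d N : ℕ} {Ω : Set (Eucl d)} {M : Fin N → Matrix (Fin d) (Fin d) ℝ} {q : Fin N → ℝ}

/-- An admissible matrix field acts on `L²(Ω; ℝᵈ)` as a symmetric coercive isomorphism. -/
theorem exists_multiplication_equiv (hm : ∀ j, 0 < minEig (M j))
    {p : (Eucl d → Fin N → ℝ) × (Eucl d → Matrix (Fin d) (Fin d) ℝ)} (hp : p ∈ admB Ω M q) :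
    ∃ T : L2Vector Ω ≃L[ℝ] L2Vector Ω,
      (∀ σ, T σ =ᵐ[volume.restrict Ω] fun x => (p.2 x).toEuclideanLin (σ x)) ∧
      (∀ σ, T.symm σ =ᵐ[volume.restrict Ω] fun x => (p.2 x)⁻¹.toEuclideanLin (σ x)) ∧
      (∀ σ τ, inner ℝ (T σ) τ = inner ℝ σ (T τ)) ∧
      ∃ α > 0, ∀ σ, α * ‖σ‖ ^ 2 ≤ inner ℝ (T σ) σ := by
  obtain ⟨hθ, hA, hsym, hbd⟩ := hp
  obtain ⟨T, hT⟩ := exists_multiplication_clm (memLp_toEuclideanCLM hA)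
  have hT' : ∀ σ, T σ =ᵐ[volume.restrict Ω] fun x => (p.2 x).toEuclideanLin (σ x) := hT
  set α := (1 + ∑ j, (minEig (M j))⁻¹)⁻¹
  have hα : 0 < α := inv_pos.2 (add_pos_of_pos_of_nonneg one_pos
    (Finset.sum_nonneg fun j _ => (inv_pos.2 (hm j)).le))
  have hco : ∀ σ, α * ‖σ‖ ^ 2 ≤ inner ℝ (T σ) σ := fun σ => by
    rw [norm_sq_eq_integral_norm_sq, L2.inner_def, ← integral_const_mul]
    refine integral_mono_ae ?_ (L2.integrable_inner _ _) ?_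
    · simpa using (L2.integrable_inner (𝕜 := ℝ) σ σ).const_mul α
    · filter_upwards [hT' σ, hbd, hθ.2.1] with x hx hb ht
      rw [hx]
      refine le_trans ?_ (inner_toEuclideanLin_ge hb.1 _)
      gcongr
      exact inv_one_add_sum_le_lamMinus hm ht
  obtain ⟨e, he⟩ := exists_continuousLinearEquiv_of_coercive T hα hco
  refine ⟨e, fun σ => by rw [he]; exact hT' σ, fun σ => ?_, fun σ τ => ?_, α, hα, fun σ => by
    rw [he]; exact hco σ⟩
  -- Applying the operator to `e.symm σ` gives `σ = A (e.symm σ)` almost everywhere, so the abstract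
  -- inverse is the pointwise one.
  · have h1 := hT' (e.symm σ)
    rw [← he, e.apply_symm_apply] at h1
    filter_upwards [h1, hbd, hθ.2.1] with x hx hb ht
    rw [hx, toEuclideanLin_inv_apply_apply]
    exact isUnit_of_coercive (lamMinus_pos hm ht) (inner_toEuclideanLin_ge hb.1)
  · rw [he, he, L2.inner_def, L2.inner_def]
    refine integral_congr_ae ?_
    filter_upwards [hT' σ, hT' τ, hsym] with x h1 h2 hs
    rw [h1, h2]
    refine Matrix.isSymmetric_toEuclideanLin_iff.2 ?_ _ _
    rwa [Matrix.IsHermitian, Matrix.conjTranspose_eq_transpose_of_trivial]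

theorem isoField_mem_admB (hm : ∀ j, 0 < minEig (M j)) (hmM : ∀ j, minEig (M j) ≤ maxEig (M j))
    {θ : Eucl d → Fin N → ℝ} (hθ : θ ∈ admT Ω q) : (θ, isoField M θ) ∈ admB Ω M q := by
  have hmeas : AEStronglyMeasurable (fun x => lamMinus M (θ x)) (volume.restrict Ω) := by
    have h1 : ∀ j, AEMeasurable (fun x => θ x j) (volume.restrict Ω) := fun j =>
      (measurable_pi_apply j).comp_aemeasurable hθ.1.1.aemeasurable
    have : AEMeasurable (fun x => ∑ j, θ x j / minEig (M j)) (volume.restrict Ω) :=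
      Finset.aemeasurable_fun_sum _ fun j _ => (h1 j).div_const _
    exact this.inv.aestronglyMeasurable
  have hmem : MemLp (fun x => lamMinus M (θ x)) ∞ (volume.restrict Ω) := by
    refine memLp_top_of_bound hmeas (∑ j, maxEig (M j)) ?_
    filter_upwards [hθ.2.1] with x ht
    rw [Real.norm_of_nonneg (lamMinus_pos hm ht).le]
    exact (lamMinus_le_lamPlus hm hmM ht).trans (lamPlus_le hm hmM ht)
  refine ⟨hθ, fun k l => ?_, ?_, ?_⟩
  · simpa [isoField, mul_comm] using hmem.const_mul ((1 : Matrix (Fin d) (Fin d) ℝ) k l)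
  · filter_upwards with x
    simp [isoField, Matrix.IsSymm]
  · filter_upwards [hθ.2.1] with x ht
    refine ⟨by simpa [isoField] using Matrix.PosSemidef.zero, ?_⟩
    simp only [isoField, ← sub_smul]
    exact Matrix.PosSemidef.one.smul (sub_nonneg.2 (lamMinus_le_lamPlus hm hmM ht))

end Field

/-! ### State equations and dual energies -/

section Energy

variable {d N m : ℕ} {Ω : Set (Eucl d)} {M : Fin N → Matrix (Fin d) (Fin d) ℝ} {q : Fin N → ℝ}
  {μ : Fin m → ℝ} {f : Fin m → Hneg1 Ω}
  {p : (Eucl d → Fin N → ℝ) × (Eucl d → Matrix (Fin d) (Fin d) ℝ)}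

theorem integral_inner_eq_inner (σ τ : L2Vector Ω) :
    ∫ x in Ω, inner ℝ (σ x) (τ x) = inner ℝ σ τ := by
  rw [L2.inner_def]

theorem isState_iff_inner {A : Eucl d → Matrix (Fin d) (Fin d) ℝ}
    {T : L2Vector Ω → L2Vector Ω}
    (hT : ∀ σ, T σ =ᵐ[volume.restrict Ω] fun x => (A x).toEuclideanLin (σ x))
    (g : Hneg1 Ω) (u : H10 Ω) :
    IsState A g u ↔ ∀ v, inner ℝ (T (weakGradCLM Ω u)) (weakGradCLM Ω v) = g v := by
  refine forall_congr' fun v => ?_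
  rw [← integral_inner_eq_inner]
  have : ∫ x in Ω, inner ℝ ((A x).toEuclideanLin (weakGrad u x)) (weakGrad v x) =
      ∫ x in Ω, inner ℝ (T (weakGradCLM Ω u) x) (weakGradCLM Ω v x) := by
    refine integral_congr_ae ?_
    filter_upwards [hT (weakGradCLM Ω u)] with x hx
    rw [hx]
    rfl
  rw [this]

theorem existsUnique_isState (hd : 1 ≤ d) (hΩb : Bornology.IsBounded Ω)
    (hm : ∀ j, 0 < minEig (M j)) (hp : p ∈ admB Ω M q) (g : Hneg1 Ω) :
    ∃! u : H10 Ω, IsState p.2 g u := by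
  obtain ⟨T, hT, -, -, α, hα, hco⟩ := exists_multiplication_equiv hm hp
  obtain ⟨C, hC⟩ := exists_norm_le_mul_norm_weakGrad hd hΩb
  have h := existsUnique_inner_comp_eq (weakGradCLM Ω) hC (T : L2Vector Ω →L[ℝ] L2Vector Ω)
    hα hco g
  simp only [isState_iff_inner hT]
  exact h

theorem isState_state {A : Eucl d → Matrix (Fin d) (Fin d) ℝ} {g : Hneg1 Ω}
    (h : ∃! u : H10 Ω, IsState A g u) : IsState A g (state A g) := by
  rw [state, dif_pos h.exists]
  exact h.exists.choose_spec

theorem dualEnergy_eq_sum_inner {A : Eucl d → Matrix (Fin d) (Fin d) ℝ}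
    {R : L2Vector Ω → L2Vector Ω}
    (hR : ∀ σ, R σ =ᵐ[volume.restrict Ω] fun x => (A x)⁻¹.toEuclideanLin (σ x))
    (σ : Fin m → L2Vector Ω) :
    dualEnergy μ A σ = ∑ i, μ i * inner ℝ (R (σ i)) (σ i) := by
  refine Finset.sum_congr rfl fun i _ => ?_
  rw [← integral_inner_eq_inner]
  congr 1
  refine integral_congr_ae ?_
  filter_upwards [hR (σ i)] with x hx
  rw [hx]

/-- The flux of the state equations minimizes the dual energy among all admissible fluxes. -/
theorem exists_flux (hd : 1 ≤ d) (hΩb : Bornology.IsBounded Ω)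
    (hm : ∀ j, 0 < minEig (M j)) (hp : p ∈ admB Ω M q) (μ : Fin m → ℝ) (f : Fin m → Hneg1 Ω) :
    ∃ τ ∈ fluxS f,
      (∀ i, τ i =ᵐ[volume.restrict Ω]
        fun x => (p.2 x).toEuclideanLin (weakGrad (state p.2 (f i)) x)) ∧
      (∀ i, weakGrad (state p.2 (f i)) =ᵐ[volume.restrict Ω]
        fun x => (p.2 x)⁻¹.toEuclideanLin (τ i x)) ∧
      ∀ σ ∈ fluxS f, dualEnergy μ p.2 σ = funJ μ f p + dualEnergy μ p.2 (σ - τ) := by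
  obtain ⟨T, hT, hTs, hsym, -⟩ := exists_multiplication_equiv hm hp
  have hst : ∀ i v, inner ℝ (T (weakGradCLM Ω (state p.2 (f i)))) (weakGradCLM Ω v) = f i v :=
    fun i => (isState_iff_inner hT _ _).1
      (isState_state (existsUnique_isState hd hΩb hm hp (f i)))
  refine ⟨fun i => T (weakGradCLM Ω (state p.2 (f i))), fun i v => ?_, fun i => hT _,
    fun i => ?_, fun σ hσ => ?_⟩
  · rw [integral_inner_eq_inner]
    exact hst i v
  · have := hTs (T (weakGradCLM Ω (state p.2 (f i))))
    rwa [T.symm_apply_apply] at this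
  · rw [dualEnergy_eq_sum_inner hTs, dualEnergy_eq_sum_inner hTs, funJ, ← Finset.sum_add_distrib]
    refine Finset.sum_congr rfl fun i _ => ?_
    rw [← mul_add]
    congr 1
    refine inner_symm_apply_eq_add (weakGradCLM Ω) T hsym (f i) (hst i) fun v => ?_
    rw [← integral_inner_eq_inner]
    exact hσ i v

theorem continuous_dualEnergy (hm : ∀ j, 0 < minEig (M j)) (hp : p ∈ admB Ω M q)
    (μ : Fin m → ℝ) : Continuous (dualEnergy (Ω := Ω) μ p.2) := by
  obtain ⟨T, -, hTs, -⟩ := exists_multiplication_equiv hm hp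
  have : dualEnergy (Ω := Ω) μ p.2 = fun σ => ∑ i, μ i * inner ℝ (T.symm (σ i)) (σ i) :=
    funext fun σ => dualEnergy_eq_sum_inner hTs σ
  rw [this]
  have := T.symm.continuous
  fun_prop

/-- Each component is controlled by coercivity of the inverse operator. The norm on `Fin m →
L2Vector Ω` is the supremum norm, and `1 + ∑ (μ i)⁻¹` bounds every `(μ i)⁻¹` while staying positive
when `m = 0`. -/
theorem exists_mul_norm_sq_le_dualEnergy (hm : ∀ j, 0 < minEig (M j)) (hp : p ∈ admB Ω M q)
    (hμ : ∀ i, 0 < μ i) :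
    ∃ κ > 0, ∀ σ : Fin m → L2Vector Ω, κ * ‖σ‖ ^ 2 ≤ dualEnergy μ p.2 σ := by
  obtain ⟨T, -, hTs, -, α, hα, hco⟩ := exists_multiplication_equiv hm hp
  obtain ⟨κ, hκ, hk⟩ := exists_mul_norm_sq_le_inner_symm T hα hco
  have hS : 0 ≤ ∑ i, (μ i)⁻¹ := Finset.sum_nonneg fun i _ => (inv_pos.2 (hμ i)).le
  refine ⟨κ / (1 + ∑ i, (μ i)⁻¹), by positivity, fun σ => ?_⟩
  rw [dualEnergy_eq_sum_inner hTs]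
  set D := ∑ i, μ i * inner ℝ (T.symm (σ i)) (σ i)
  have hnn : ∀ i, 0 ≤ μ i * inner ℝ (T.symm (σ i)) (σ i) := fun i =>
    mul_nonneg (hμ i).le (le_trans (by positivity) (hk (σ i)))
  have hD : 0 ≤ D := Finset.sum_nonneg fun i _ => hnn i
  have h1 : ‖σ‖ ≤ √((1 + ∑ i, (μ i)⁻¹) * D / κ) := by
    rw [pi_norm_le_iff_of_nonneg (Real.sqrt_nonneg _)]
    intro i
    refine Real.le_sqrt_of_sq_le ?_
    rw [le_div_iff₀ hκ]
    have h2 : μ i * inner ℝ (T.symm (σ i)) (σ i) ≤ D :=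
      Finset.single_le_sum (f := fun i => μ i * inner ℝ (T.symm (σ i)) (σ i))
        (fun i _ => hnn i) (Finset.mem_univ i)
    have h3 : (μ i)⁻¹ ≤ 1 + ∑ i, (μ i)⁻¹ := by
      have := Finset.single_le_sum (f := fun i => (μ i)⁻¹)
        (fun i _ => (inv_pos.2 (hμ i)).le) (Finset.mem_univ i)
      linarith
    calc ‖σ i‖ ^ 2 * κ ≤ inner ℝ (T.symm (σ i)) (σ i) := by linarith [hk (σ i)]
      _ = (μ i)⁻¹ * (μ i * inner ℝ (T.symm (σ i)) (σ i)) :=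
        (inv_mul_cancel_left₀ (hμ i).ne' _).symm
      _ ≤ (μ i)⁻¹ * D := by
        have := (inv_pos.2 (hμ i)).le
        gcongr
      _ ≤ _ := by gcongr
  rw [div_mul_eq_mul_div, div_le_iff₀ (by positivity)]
  have h4 : ‖σ‖ ^ 2 ≤ (1 + ∑ i, (μ i)⁻¹) * D / κ := by
    rw [← Real.sq_sqrt (by positivity : 0 ≤ (1 + ∑ i, (μ i)⁻¹) * D / κ)]
    gcongr
  rw [le_div_iff₀ hκ] at h4
  linarith

theorem dualEnergy_nonneg (hm : ∀ j, 0 < minEig (M j)) (hp : p ∈ admB Ω M q)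
    (hμ : ∀ i, 0 < μ i) (σ : Fin m → L2Vector Ω) : 0 ≤ dualEnergy μ p.2 σ := by
  obtain ⟨κ, hκ, h⟩ := exists_mul_norm_sq_le_dualEnergy hm hp hμ
  exact le_trans (by positivity) (h σ)

theorem eq_zero_of_dualEnergy_nonpos (hm : ∀ j, 0 < minEig (M j)) (hp : p ∈ admB Ω M q)
    (hμ : ∀ i, 0 < μ i) {σ : Fin m → L2Vector Ω} (h0 : dualEnergy μ p.2 σ ≤ 0) : σ = 0 := by
  obtain ⟨κ, hκ, h⟩ := exists_mul_norm_sq_le_dualEnergy hm hp hμ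
  have h1 : ‖σ‖ ^ 2 ≤ 0 := by
    by_contra hn
    push Not at hn
    linarith [mul_pos hκ hn, h σ]
  exact norm_eq_zero.1 (pow_eq_zero_iff two_ne_zero |>.1 (le_antisymm h1 (sq_nonneg _)))

theorem dualEnergy_flux (hm : ∀ j, 0 < minEig (M j)) (hp : p ∈ admB Ω M q)
    {τ : Fin m → L2Vector Ω} {J : ℝ} (h : dualEnergy μ p.2 τ = J + dualEnergy μ p.2 (τ - τ)) :
    dualEnergy μ p.2 τ = J := by
  obtain ⟨T, -, hTs, -⟩ := exists_multiplication_equiv hm hp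
  have h0 : dualEnergy μ p.2 (0 : Fin m → L2Vector Ω) = 0 := by
    simp [dualEnergy_eq_sum_inner hTs]
  rw [h, sub_self, h0, add_zero]

/-! ### Comparison of the dual energy with `H` -/

/-- Through this identity the flux decomposition, continuity and strong convexity of dual energies
apply to `H(θ, ·)`. -/
theorem funH_eq_dualEnergy (hm : ∀ j, 0 < minEig (M j)) {θ : Eucl d → Fin N → ℝ}
    (hθ : θ ∈ admT Ω q) (σ : Fin m → L2Vector Ω) :
    funH M μ θ σ = dualEnergy μ (isoField M θ) σ := by
  refine Finset.sum_congr rfl fun i _ => ?_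
  congr 1
  refine integral_congr_ae ?_
  filter_upwards [hθ.2.1] with x ht
  rw [isoField, toEuclideanLin_inv_smul_one (lamMinus_pos hm ht).ne', real_inner_smul_left,
    real_inner_self_eq_norm_sq]
  ring

theorem integrable_norm_sq_div_lamMinus (hm : ∀ j, 0 < minEig (M j))
    (hmM : ∀ j, minEig (M j) ≤ maxEig (M j)) {θ : Eucl d → Fin N → ℝ}
    (hθ : θ ∈ admT Ω q) (σ : L2Vector Ω) :
    Integrable (fun x => ‖σ x‖ ^ 2 / lamMinus M (θ x)) (volume.restrict Ω) := by
  obtain ⟨T, -, hTs, -⟩ := exists_multiplication_equiv hm (isoField_mem_admB hm hmM hθ)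
  refine (L2.integrable_inner (𝕜 := ℝ) (T.symm σ) σ).congr ?_
  filter_upwards [hTs σ, hθ.2.1] with x hx ht
  rw [hx, isoField, toEuclideanLin_inv_smul_one (lamMinus_pos hm ht).ne', real_inner_smul_left,
    real_inner_self_eq_norm_sq]
  ring

theorem integrable_inner_inv (hm : ∀ j, 0 < minEig (M j)) (hp : p ∈ admB Ω M q)
    (σ : L2Vector Ω) :
    Integrable (fun x => inner ℝ ((p.2 x)⁻¹.toEuclideanLin (σ x)) (σ x))
      (volume.restrict Ω) := by
  obtain ⟨T, -, hTs, -⟩ := exists_multiplication_equiv hm hp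
  refine (L2.integrable_inner (𝕜 := ℝ) (T.symm σ) σ).congr ?_
  filter_upwards [hTs σ] with x hx
  rw [hx]

theorem ae_inner_inv_add_le (hm : ∀ j, 0 < minEig (M j)) (hp : p ∈ admB Ω M q)
    (σ : L2Vector Ω) : ∀ᵐ x ∂volume.restrict Ω,
      inner ℝ ((p.2 x)⁻¹.toEuclideanLin (σ x)) (σ x) +
        ‖σ x - lamMinus M (p.1 x) • (p.2 x)⁻¹.toEuclideanLin (σ x)‖ ^ 2 / lamMinus M (p.1 x) ≤
      ‖σ x‖ ^ 2 / lamMinus M (p.1 x) := by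
  filter_upwards [hp.1.2.1, hp.2.2.2] with x ht hb
  exact inner_inv_add_le (lamMinus_pos hm ht) (inner_toEuclideanLin_ge hb.1) _

theorem ae_inner_inv_le (hm : ∀ j, 0 < minEig (M j)) (hp : p ∈ admB Ω M q)
    (σ : L2Vector Ω) : ∀ᵐ x ∂volume.restrict Ω,
      inner ℝ ((p.2 x)⁻¹.toEuclideanLin (σ x)) (σ x) ≤ ‖σ x‖ ^ 2 / lamMinus M (p.1 x) := by
  filter_upwards [ae_inner_inv_add_le hm hp σ, hp.1.2.1] with x hx ht
  have := lamMinus_pos hm ht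
  exact (le_add_of_nonneg_right (by positivity)).trans hx

theorem dualEnergy_le_funH (hm : ∀ j, 0 < minEig (M j))
    (hmM : ∀ j, minEig (M j) ≤ maxEig (M j)) (hp : p ∈ admB Ω M q) (hμ : ∀ i, 0 < μ i)
    (σ : Fin m → L2Vector Ω) : dualEnergy μ p.2 σ ≤ funH M μ p.1 σ := by
  refine Finset.sum_le_sum fun i _ => mul_le_mul_of_nonneg_left ?_ (hμ i).le
  exact integral_mono_ae (integrable_inner_inv hm hp _)
    (integrable_norm_sq_div_lamMinus hm hmM hp.1 _) (ae_inner_inv_le hm hp _)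

/-- The integrals are ordered for each `i` and the weights are positive, so equality of the sums
forces equality of every integral, then of the integrands almost everywhere. The defect term of
`ae_inner_inv_add_le` must therefore vanish. -/
theorem optCond_of_funH_le_dualEnergy (hm : ∀ j, 0 < minEig (M j))
    (hmM : ∀ j, minEig (M j) ≤ maxEig (M j)) (hp : p ∈ admB Ω M q) (hμ : ∀ i, 0 < μ i)
    {σ : Fin m → L2Vector Ω} (h : funH M μ p.1 σ ≤ dualEnergy μ p.2 σ) :
    OptCond M p.1 p.2 σ := by
  intro i
  have hle : ∀ i, ∫ x in Ω, inner ℝ ((p.2 x)⁻¹.toEuclideanLin (σ i x)) (σ i x) ≤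
      ∫ x in Ω, ‖σ i x‖ ^ 2 / lamMinus M (p.1 x) := fun i =>
    integral_mono_ae (integrable_inner_inv hm hp _)
      (integrable_norm_sq_div_lamMinus hm hmM hp.1 _) (ae_inner_inv_le hm hp _)
  have heq : ∫ x in Ω, inner ℝ ((p.2 x)⁻¹.toEuclideanLin (σ i x)) (σ i x) =
      ∫ x in Ω, ‖σ i x‖ ^ 2 / lamMinus M (p.1 x) := by
    refine le_antisymm (hle i) ?_
    by_contra hlt
    push Not at hlt
    refine absurd h (not_le.2 ?_)
    exact Finset.sum_lt_sum (fun j _ => mul_le_mul_of_nonneg_left (hle j) (hμ j).le)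
      ⟨i, Finset.mem_univ _, mul_lt_mul_of_pos_left hlt (hμ i)⟩
  have hae := (integral_eq_iff_of_ae_le (integrable_inner_inv hm hp (σ i))
    (integrable_norm_sq_div_lamMinus hm hmM hp.1 (σ i)) (ae_inner_inv_le hm hp (σ i))).1 heq
  filter_upwards [hae, ae_inner_inv_add_le hm hp (σ i), hp.1.2.1] with x h1 h2 ht
  have hl := lamMinus_pos hm ht
  rw [h1, add_le_iff_nonpos_right] at h2
  have h3 : ‖σ i x - lamMinus M (p.1 x) • (p.2 x)⁻¹.toEuclideanLin (σ i x)‖ ^ 2 ≤ 0 := by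
    by_contra hn
    push Not at hn
    linarith [div_pos hn hl]
  have h4 := norm_eq_zero.1 (pow_eq_zero_iff two_ne_zero |>.1 (le_antisymm h3 (sq_nonneg _)))
  rw [sub_eq_zero] at h4
  conv_rhs => rw [h4]
  rw [smul_smul, one_div, inv_mul_cancel₀ hl.ne', one_smul]

/-- If two admissible fields have inverses that agree on the flux of the first one, then they
have the same state. -/
theorem state_eq_of_inv_flux_eq (hd : 1 ≤ d) (hΩb : Bornology.IsBounded Ω)
    (hm : ∀ j, 0 < minEig (M j)) {p' : (Eucl d → Fin N → ℝ) × (Eucl d → Matrix (Fin d) (Fin d) ℝ)}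
    (hp' : p' ∈ admB Ω M q) {g : Hneg1 Ω} {τ : L2Vector Ω}
    (hτ : ∀ v : H10 Ω, ∫ x in Ω, inner ℝ (τ x) (weakGrad v x) = g v)
    (hw : weakGrad (state p.2 g) =ᵐ[volume.restrict Ω] fun x => (p.2 x)⁻¹.toEuclideanLin (τ x))
    (heq : ∀ᵐ x ∂volume.restrict Ω,
      (p.2 x)⁻¹.toEuclideanLin (τ x) = (p'.2 x)⁻¹.toEuclideanLin (τ x)) :
    state p.2 g = state p'.2 g := by
  have hu := existsUnique_isState hd hΩb hm hp' g
  -- The first state also solves the second equation, because `A' ∇u = A' A'⁻¹ τ = τ`.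
  refine hu.unique (fun v => ?_) (isState_state hu)
  rw [← hτ v]
  refine integral_congr_ae ?_
  filter_upwards [hw, heq, hp'.1.2.1, hp'.2.2.2] with x h1 h2 ht hb
  rw [h1, h2, toEuclideanLin_apply_inv_apply]
  exact isUnit_of_coercive (lamMinus_pos hm ht) (inner_toEuclideanLin_ge hb.1)

end Energy

/-! ### The set of admissible proportions -/

section Proportions

variable {d N m : ℕ} {Ω : Set (Eucl d)} {M : Fin N → Matrix (Fin d) (Fin d) ℝ} {q : Fin N → ℝ}
  {μ : Fin m → ℝ} {f : Fin m → Hneg1 Ω}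

theorem convex_propSimplex (N : ℕ) : Convex ℝ (propSimplex N) := by
  rintro a ⟨ha, ha1⟩ b ⟨hb, hb1⟩ s t hs ht hst
  refine ⟨fun j => convex_Icc (0 : ℝ) 1 (ha j) (hb j) hs ht hst, ?_⟩
  simp only [Pi.add_apply, Pi.smul_apply, smul_eq_mul, Finset.sum_add_distrib, ← Finset.mul_sum,
    ha1, hb1, mul_one, hst]

theorem isClosed_propSimplex (N : ℕ) : IsClosed (propSimplex N) := by
  have h1 : IsClosed {t : Fin N → ℝ | ∀ j, t j ∈ Set.Icc (0 : ℝ) 1} := by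
    simp only [Set.ofPred_forall]
    exact isClosed_iInter fun j => isClosed_Icc.preimage (continuous_apply j)
  exact h1.inter (isClosed_eq (by fun_prop) continuous_const)

theorem integrable_apply_of_mem_admT [IsFiniteMeasure (volume.restrict Ω)]
    {θ : Eucl d → Fin N → ℝ} (hθ : θ ∈ admT Ω q) (j : Fin N) :
    Integrable (fun x => θ x j) (volume.restrict Ω) :=
  (hθ.1.eval j).integrable le_top

theorem convex_admT [IsFiniteMeasure (volume.restrict Ω)] : Convex ℝ (admT Ω q) := by
  rintro a ha b hb s t hs ht hst
  refine ⟨(ha.1.const_smul s).add (hb.1.const_smul t), ?_, fun j => ?_⟩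
  · filter_upwards [ha.2.1, hb.2.1] with x h1 h2 using convex_propSimplex N h1 h2 hs ht hst
  · simp only [Pi.add_apply, Pi.smul_apply, smul_eq_mul]
    rw [integral_add ((integrable_apply_of_mem_admT ha j).const_mul s)
      ((integrable_apply_of_mem_admT hb j).const_mul t), integral_const_mul, integral_const_mul,
      ha.2.2, hb.2.2, ← add_mul, hst, one_mul]

theorem admT_congr {θ θ' : Eucl d → Fin N → ℝ} (h : θ =ᵐ[volume.restrict Ω] θ')
    (hθ : θ ∈ admT Ω q) : θ' ∈ admT Ω q := by
  refine ⟨(memLp_congr_ae h).1 hθ.1, ?_, fun j => ?_⟩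
  · filter_upwards [h, hθ.2.1] with x hx ht
    rwa [← hx]
  · rw [← hθ.2.2 j]
    refine integral_congr_ae ?_
    filter_upwards [h] with x hx
    rw [hx]

theorem funH_congr {θ θ' : Eucl d → Fin N → ℝ} (h : θ =ᵐ[volume.restrict Ω] θ')
    (σ : Fin m → L2Vector Ω) : funH M μ θ σ = funH M μ θ' σ := by
  refine Finset.sum_congr rfl fun i _ => ?_
  congr 1
  refine integral_congr_ae ?_
  filter_upwards [h] with x hx
  rw [hx]

theorem admT_nonempty [IsFiniteMeasure (volume.restrict Ω)]
    (hq : ∀ j, 0 ≤ q j) (hqΩ : ∑ j, q j = volume.real Ω) : (admT Ω q).Nonempty := by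
  have hqle : ∀ j, q j ≤ volume.real Ω := fun j => hqΩ ▸
    Finset.single_le_sum (fun i _ => hq i) (Finset.mem_univ j)
  have hfin : volume Ω ≠ ⊤ := by
    rw [← Measure.restrict_apply_univ]
    exact measure_ne_top _ _
  -- Constant proportions work. If `Ω` is null, the pointwise condition is void and every `q j` is
  -- 0.
  refine ⟨fun _ j => q j / volume.real Ω, memLp_const _, ?_, fun j => ?_⟩
  · by_cases h0 : volume.real Ω = 0
    · have : volume Ω = 0 := (measureReal_eq_zero_iff hfin).1 h0
      rw [Measure.restrict_zero_set this]
      simp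
    · refine Filter.Eventually.of_forall fun x => ⟨fun j => ⟨?_, ?_⟩, ?_⟩
      · exact div_nonneg (hq j) measureReal_nonneg
      · exact div_le_one_of_le₀ (hqle j) measureReal_nonneg
      · rw [← Finset.sum_div, hqΩ, div_self h0]
  · rw [integral_const, smul_eq_mul, measureReal_restrict_apply_univ]
    by_cases h0 : volume.real Ω = 0
    · rw [h0, zero_mul]
      exact (le_antisymm (h0 ▸ hqle j) (hq j)).symm
    · field_simp

theorem norm_sq_div_lamMinus_le (hm : ∀ j, 0 < minEig (M j)) {t : Fin N → ℝ}
    (ht : t ∈ propSimplex N) (v : Eucl d) :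
    ‖v‖ ^ 2 / lamMinus M t ≤ ‖v‖ ^ 2 * ∑ j, (minEig (M j))⁻¹ := by
  rw [div_eq_mul_inv, inv_lamMinus]
  exact mul_le_mul_of_nonneg_left (sum_div_minEig_le hm ht) (sq_nonneg _)

theorem funH_le (hm : ∀ j, 0 < minEig (M j)) (hmM : ∀ j, minEig (M j) ≤ maxEig (M j))
    (hμ : ∀ i, 0 < μ i) {θ : Eucl d → Fin N → ℝ} (hθ : θ ∈ admT Ω q)
    (σ : Fin m → L2Vector Ω) :
    funH M μ θ σ ≤ ∑ i, μ i * (‖σ i‖ ^ 2 * ∑ j, (minEig (M j))⁻¹) := by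
  refine Finset.sum_le_sum fun i _ => mul_le_mul_of_nonneg_left ?_ (hμ i).le
  rw [norm_sq_eq_integral_norm_sq, ← integral_mul_const]
  refine integral_mono_ae (integrable_norm_sq_div_lamMinus hm hmM hθ _) ?_ ?_
  · refine Integrable.mul_const ?_ _
    simpa using L2.integrable_inner (𝕜 := ℝ) (σ i) (σ i)
  · filter_upwards [hθ.2.1] with x ht using norm_sq_div_lamMinus_le hm ht _

/-- `H` is affine in the proportions. -/
theorem funH_convex_combination (hm : ∀ j, 0 < minEig (M j))
    (hmM : ∀ j, minEig (M j) ≤ maxEig (M j))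
    {a b : Eucl d → Fin N → ℝ} (ha : a ∈ admT Ω q) (hb : b ∈ admT Ω q) (s t : ℝ)
    (σ : Fin m → L2Vector Ω) :
    funH M μ (s • a + t • b) σ = s * funH M μ a σ + t * funH M μ b σ := by
  simp only [funH, Finset.mul_sum, ← Finset.sum_add_distrib]
  refine Finset.sum_congr rfl fun i _ => ?_
  have h : ∀ x, ‖σ i x‖ ^ 2 / lamMinus M ((s • a + t • b) x) =
      s * (‖σ i x‖ ^ 2 / lamMinus M (a x)) + t * (‖σ i x‖ ^ 2 / lamMinus M (b x)) := fun x => by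
    simp only [div_eq_mul_inv _ (lamMinus M _), inv_lamMinus, Pi.add_apply, Pi.smul_apply,
      smul_eq_mul, Finset.mul_sum, ← Finset.sum_add_distrib]
    exact Finset.sum_congr rfl fun j _ => by ring
  simp only [h]
  rw [integral_add ((integrable_norm_sq_div_lamMinus hm hmM ha _).const_mul s)
    ((integrable_norm_sq_div_lamMinus hm hmM hb _).const_mul t), integral_const_mul,
    integral_const_mul]
  ring

theorem mem_admT_of_tendsto [IsFiniteMeasure (volume.restrict Ω)]
    {θs : ℕ → Eucl d → Fin N → ℝ} {θ : Eucl d → Fin N → ℝ}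
    (hθs : ∀ n, θs n ∈ admT Ω q)
    (hlim : ∀ᵐ x ∂volume.restrict Ω, Filter.Tendsto (fun n => θs n x) Filter.atTop (nhds (θ x))) :
    θ ∈ admT Ω q := by
  have hK : ∀ᵐ x ∂volume.restrict Ω, θ x ∈ propSimplex N := by
    filter_upwards [hlim, ae_all_iff.2 fun n => (hθs n).2.1] with x hx ht
    exact (isClosed_propSimplex N).mem_of_tendsto hx (Filter.Eventually.of_forall ht)
  refine ⟨memLp_top_of_bound (aestronglyMeasurable_of_tendsto_ae Filter.atTop
    (fun n => (hθs n).1.1) hlim) 1 ?_, hK, fun j => ?_⟩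
  · filter_upwards [hK] with x ht
    rw [pi_norm_le_iff_of_nonneg zero_le_one]
    intro j
    rw [Real.norm_of_nonneg (ht.1 j).1]
    exact (ht.1 j).2
  · refine tendsto_nhds_unique (tendsto_integral_of_dominated_convergence (fun _ => 1)
      (F := fun n x => θs n x j) (fun n => ((hθs n).1.eval j).1) (integrable_const _)
      (fun n => ?_) ?_) ?_
    · filter_upwards [(hθs n).2.1] with x ht
      rw [Real.norm_of_nonneg (ht.1 j).1]
      exact (ht.1 j).2
    · filter_upwards [hlim] with x hx
      exact (continuous_apply j).tendsto _ |>.comp hx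
    · simp only [(hθs _).2.2]
      exact tendsto_const_nhds

/-- Dominated convergence applies because `1/λ₋` is linear in the proportions and bounded on the
simplex. -/
theorem tendsto_funH_of_tendsto (hm : ∀ j, 0 < minEig (M j))
    (hmM : ∀ j, minEig (M j) ≤ maxEig (M j))
    {θs : ℕ → Eucl d → Fin N → ℝ} {θ : Eucl d → Fin N → ℝ}
    (hθs : ∀ n, θs n ∈ admT Ω q)
    (hlim : ∀ᵐ x ∂volume.restrict Ω, Filter.Tendsto (fun n => θs n x) Filter.atTop (nhds (θ x)))
    (σ : Fin m → L2Vector Ω) :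
    Filter.Tendsto (fun n => funH M μ (θs n) σ) Filter.atTop (nhds (funH M μ θ σ)) := by
  refine tendsto_finsetSum _ fun i _ => Filter.Tendsto.const_mul _ ?_
  refine tendsto_integral_of_dominated_convergence
    (fun x => ‖σ i x‖ ^ 2 * ∑ j, (minEig (M j))⁻¹)
    (fun n => (integrable_norm_sq_div_lamMinus hm hmM (hθs n) (σ i)).1) ?_ (fun n => ?_) ?_
  · refine Integrable.mul_const ?_ _
    simpa using L2.integrable_inner (𝕜 := ℝ) (σ i) (σ i)
  · filter_upwards [(hθs n).2.1] with x ht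
    have := lamMinus_pos hm ht
    rw [Real.norm_of_nonneg (by positivity)]
    exact norm_sq_div_lamMinus_le hm ht _
  · filter_upwards [hlim] with x hx
    simp only [div_eq_mul_inv _ (lamMinus M _), inv_lamMinus]
    have : Continuous fun t : Fin N → ℝ => ‖σ i x‖ ^ 2 * ∑ j, t j / minEig (M j) := by fun_prop
    exact (this.tendsto _).comp hx

theorem norm_sq_toLp_le_one {t : Fin N → ℝ} (ht : t ∈ propSimplex N) :
    ‖WithLp.toLp 2 t‖ ^ 2 ≤ 1 := by
  rw [EuclideanSpace.norm_sq_eq, ← ht.2]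
  refine Finset.sum_le_sum fun j _ => ?_
  simp only [Real.norm_eq_abs, sq_abs]
  have := ht.1 j
  nlinarith [this.1, this.2]

/-- If `inf_σ H(θ, σ)` comes arbitrarily close to `s` from below, then it reaches `s`. -/
theorem exists_mem_admT_forall_le_funH [IsFiniteMeasure (volume.restrict Ω)]
    (hm : ∀ j, 0 < minEig (M j)) (hmM : ∀ j, minEig (M j) ≤ maxEig (M j))
    (S : Set (Fin m → L2Vector Ω)) {s : ℝ}
    (hs : ∀ r < s, ∃ θ ∈ admT Ω q, ∀ σ ∈ S, r ≤ funH M μ θ σ) :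
    ∃ θ ∈ admT Ω q, ∀ σ ∈ S, s ≤ funH M μ θ σ := by
  let Z := Lp (EuclideanSpace ℝ (Fin N)) 2 (volume.restrict Ω)
  let F : Z → Eucl d → Fin N → ℝ := fun g x => (g x).ofLp
  let r : ℕ → ℝ := fun n => s - 1 / ((n : ℝ) + 1)
  have hr : ∀ n, r n < s := fun n => sub_lt_self _ (by positivity)
  -- Superlevel sets of the minimum value, placed in `L²` to have Hilbert geometry. They are convex
  -- since `H` is affine in the proportions, and closed by passing to an almost everywhere
  -- convergent subsequence.
  let C : ℕ → Set Z := fun n => {g | F g ∈ admT Ω q ∧ ∀ σ ∈ S, r n ≤ funH M μ (F g) σ}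
  have hFlin : ∀ (g h : Z) (a b : ℝ), a • F g + b • F h =ᵐ[volume.restrict Ω] F (a • g + b • h) := by
    intro g h a b
    filter_upwards [Lp.coeFn_add (a • g) (b • h), Lp.coeFn_smul a g, Lp.coeFn_smul b h]
      with x h1 h2 h3
    simp only [F, h1, Pi.add_apply, h2, h3, Pi.smul_apply, WithLp.ofLp_add, WithLp.ofLp_smul]
  have hne : (⋂ n, C n).Nonempty := by
    refine nonempty_iInter_of_antitone_convex C (fun n k hnk g hg => ?_) (fun n => ?_)
      (fun n => ?_) (fun n => ?_) (R := √(volume.real Ω)) fun g hg => ?_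
    · refine ⟨hg.1, fun σ hσ => le_trans ?_ (hg.2 σ hσ)⟩
      have : 1 / ((k : ℝ) + 1) ≤ 1 / ((n : ℝ) + 1) := Nat.one_div_le_one_div hnk
      simp only [r]
      linarith
    · obtain ⟨θ, hθ, h⟩ := hs _ (hr n)
      have hmem : MemLp (fun x => WithLp.toLp 2 (θ x)) 2 (volume.restrict Ω) :=
        (MemLp.of_eval_piLp fun j => hθ.1.eval j).mono_exponent le_top
      have hF : θ =ᵐ[volume.restrict Ω] F (hmem.toLp _) := by
        filter_upwards [hmem.coeFn_toLp] with x hx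
        simp only [F, hx]
      refine ⟨hmem.toLp _, admT_congr hF hθ, fun σ hσ => ?_⟩
      rw [← funH_congr hF]
      exact h σ hσ
    · refine IsSeqClosed.isClosed fun gs g hgs hlim => ?_
      obtain ⟨k, -, hk⟩ := (tendstoInMeasure_of_tendsto_Lp hlim).exists_seq_tendsto_ae
      have hk' : ∀ᵐ x ∂volume.restrict Ω,
          Filter.Tendsto (fun n => F (gs (k n)) x) Filter.atTop (nhds (F g x)) := by
        filter_upwards [hk] with x hx
        exact ((PiLp.continuous_ofLp 2 _).tendsto _).comp hx
      refine ⟨mem_admT_of_tendsto (fun n => (hgs (k n)).1) hk', fun σ hσ => ?_⟩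
      exact ge_of_tendsto (tendsto_funH_of_tendsto hm hmM (fun n => (hgs (k n)).1) hk' σ)
        (Filter.Eventually.of_forall fun n => (hgs (k n)).2 σ hσ)
    · intro g hg h hh a b ha hb hab
      refine ⟨admT_congr (hFlin g h a b) (convex_admT hg.1 hh.1 ha hb hab), fun σ hσ => ?_⟩
      rw [← funH_congr (hFlin g h a b), funH_convex_combination hm hmM hg.1 hh.1]
      have h1 := mul_le_mul_of_nonneg_left (hg.2 σ hσ) ha
      have h2 := mul_le_mul_of_nonneg_left (hh.2 σ hσ) hb
      have h3 : r n = a * r n + b * r n := by rw [← add_mul, hab, one_mul]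
      linarith
    · refine Real.le_sqrt_of_sq_le ?_
      rw [norm_sq_eq_integral_norm_sq]
      have : ∫ _ in Ω, (1 : ℝ) = volume.real Ω := by simp
      rw [← this]
      refine integral_mono_ae ?_ (integrable_const _) ?_
      · simpa using L2.integrable_inner (𝕜 := ℝ) g g
      · filter_upwards [hg.1.2.1] with x ht using norm_sq_toLp_le_one ht
  obtain ⟨g, hg⟩ := hne
  rw [Set.mem_iInter] at hg
  refine ⟨F g, (hg 0).1, fun σ hσ => ?_⟩
  have hlim : Filter.Tendsto r Filter.atTop (nhds (s - 0)) :=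
    tendsto_one_div_add_atTop_nhds_zero_nat.const_sub s
  rw [sub_zero] at hlim
  exact le_of_tendsto' hlim fun n => (hg n).2 σ hσ

end Proportions

/-! ### Saddle points -/

section Saddle

variable {d N m : ℕ} {Ω : Set (Eucl d)} {M : Fin N → Matrix (Fin d) (Fin d) ℝ} {q : Fin N → ℝ}
  {μ : Fin m → ℝ} {f : Fin m → Hneg1 Ω}

theorem exists_isSaddle (hd : 1 ≤ d) (hΩb : Bornology.IsBounded Ω)
    [IsFiniteMeasure (volume.restrict Ω)]
    (hm : ∀ j, 0 < minEig (M j)) (hmM : ∀ j, minEig (M j) ≤ maxEig (M j))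
    (hne : (admT Ω q).Nonempty) (hμ : ∀ i, 0 < μ i) :
    ∃ θ σ, IsSaddle M q μ f θ σ := by
  have hflux : ∀ θ : Eucl d → Fin N → ℝ, ∃ τ : Fin m → L2Vector Ω, θ ∈ admT Ω q →
      τ ∈ fluxS f ∧ ∀ σ ∈ fluxS f, funH M μ θ σ = funH M μ θ τ + funH M μ θ (σ - τ) := by
    intro θ
    by_cases hθ : θ ∈ admT Ω q
    · have hp := isoField_mem_admB hm hmM hθ
      obtain ⟨τ, hτ, -, -, h⟩ := exists_flux hd hΩb hm hp μ f
      refine ⟨τ, fun _ => ⟨hτ, fun σ hσ => ?_⟩⟩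
      simp only [funH_eq_dualEnergy hm hθ]
      rw [h σ hσ, dualEnergy_flux hm hp (h τ hτ)]
    · exact ⟨0, fun h => absurd h hθ⟩
  choose φ hφ using hflux
  have hnn : ∀ θ ∈ admT Ω q, ∀ σ : Fin m → L2Vector Ω, 0 ≤ funH M μ θ σ := fun θ hθ σ => by
    rw [funH_eq_dualEnergy hm hθ]
    exact dualEnergy_nonneg hm (isoField_mem_admB hm hmM hθ) hμ σ
  have hmin : ∀ θ ∈ admT Ω q, ∀ σ ∈ fluxS f, funH M μ θ (φ θ) ≤ funH M μ θ σ :=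
    fun θ hθ σ hσ => by
      rw [(hφ θ hθ).2 σ hσ]
      exact le_add_of_nonneg_right (hnn θ hθ _)
  let V : Set ℝ := (fun θ => funH M μ θ (φ θ)) '' admT Ω q
  have hV : V.Nonempty := hne.image _
  have hVb : BddAbove V := by
    obtain ⟨θ₀, hθ₀⟩ := hne
    -- One fixed admissible flux, that of `θ₀`, bounds all minimum values at once.
    refine ⟨∑ i, μ i * (‖φ θ₀ i‖ ^ 2 * ∑ j, (minEig (M j))⁻¹), ?_⟩
    rintro _ ⟨θ, hθ, rfl⟩
    exact (hmin θ hθ _ (hφ θ₀ hθ₀).1).trans (funH_le hm hmM hμ hθ _)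
  obtain ⟨θ, hθ, hge⟩ := exists_mem_admT_forall_le_funH (q := q) (μ := μ) hm hmM
    (fluxS f) (s := sSup V) fun r hr => by
      obtain ⟨_, ⟨θ, hθ, rfl⟩, h⟩ := exists_lt_of_lt_csSup hV hr
      exact ⟨θ, hθ, fun σ hσ => h.le.trans (hmin θ hθ σ hσ)⟩
  have h := exists_saddle_of_isMax_min (T := admT Ω q) (S := fluxS f) (H := funH M μ)
    convex_admT (fun a ha b hb t _ s => funH_convex_combination hm hmM ha hb _ _ s) hnn
    (fun a ha => by
      have : funH (Ω := Ω) M μ a = dualEnergy μ (isoField M a) :=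
        funext fun σ => funH_eq_dualEnergy hm ha σ
      rw [this]
      exact continuous_dualEnergy hm (isoField_mem_admB hm hmM ha) μ)
    φ (fun a ha => (hφ a ha).1)
    (fun a ha => by
      obtain ⟨κ, hκ, hk⟩ := exists_mul_norm_sq_le_dualEnergy hm (isoField_mem_admB hm hmM ha) hμ
      refine ⟨κ, hκ, fun s hs => ?_⟩
      rw [(hφ a ha).2 s hs, dist_eq_norm, funH_eq_dualEnergy hm ha (s - φ a)]
      gcongr
      exact hk _)
    hθ fun b hb => (le_csSup hVb ⟨b, hb, rfl⟩).trans (hge _ (hφ θ hθ).1)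
  exact ⟨θ, φ θ, hθ, (hφ θ hθ).1, h.1, h.2⟩

theorem IsSaddle.funH_eq {θ₁ θ₂ : Eucl d → Fin N → ℝ} {σ₁ σ₂ : Fin m → L2Vector Ω}
    (h₁ : IsSaddle M q μ f θ₁ σ₁) (h₂ : IsSaddle M q μ f θ₂ σ₂) :
    funH M μ θ₁ σ₁ = funH M μ θ₂ σ₂ :=
  le_antisymm ((h₁.2.2.2 _ h₂.2.1).trans (h₂.2.2.1 _ h₁.1))
    ((h₂.2.2.2 _ h₁.2.1).trans (h₁.2.2.1 _ h₂.1))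

/-- The cross value `H(θ₁, σ₂)` is squeezed between the two equal saddle values, so the mixed pair
inherits one inequality from each saddle point. -/
theorem IsSaddle.exchange {θ₁ θ₂ : Eucl d → Fin N → ℝ} {σ₁ σ₂ : Fin m → L2Vector Ω}
    (h₁ : IsSaddle M q μ f θ₁ σ₁) (h₂ : IsSaddle M q μ f θ₂ σ₂) :
    IsSaddle M q μ f θ₁ σ₂ := by
  have e := h₁.funH_eq h₂
  have e' : funH M μ θ₁ σ₂ = funH M μ θ₁ σ₁ :=
    le_antisymm ((h₂.2.2.1 _ h₁.1).trans e.ge) (h₁.2.2.2 _ h₂.2.1)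
  refine ⟨h₁.1, h₂.2.1, fun θ hθ => ?_, fun σ hσ => ?_⟩
  · rw [e', e]
    exact h₂.2.2.1 θ hθ
  · rw [e']
    exact h₁.2.2.2 σ hσ

/-- A minimizer of the dual energy of an admissible field is the flux of its states. -/
theorem eq_flux_of_dualEnergy_le (hm : ∀ j, 0 < minEig (M j))
    {p : (Eucl d → Fin N → ℝ) × (Eucl d → Matrix (Fin d) (Fin d) ℝ)} (hp : p ∈ admB Ω M q)
    (hμ : ∀ i, 0 < μ i) {τ σ : Fin m → L2Vector Ω} {J : ℝ}
    (h : dualEnergy μ p.2 σ = J + dualEnergy μ p.2 (σ - τ)) (hle : dualEnergy μ p.2 σ ≤ J) :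
    σ = τ :=
  sub_eq_zero.1 (eq_zero_of_dualEnergy_nonpos hm hp hμ (by linarith))

/-- The saddle inequality in the second variable says that the flux minimizes the dual energy of the
isotropic field; such a minimizer is the flux of the states. -/
theorem IsSaddle.funJ_isoField (hd : 1 ≤ d) (hΩb : Bornology.IsBounded Ω)
    (hm : ∀ j, 0 < minEig (M j)) (hmM : ∀ j, minEig (M j) ≤ maxEig (M j)) (hμ : ∀ i, 0 < μ i)
    {θ : Eucl d → Fin N → ℝ} {σ : Fin m → L2Vector Ω} (h : IsSaddle M q μ f θ σ) :
    funJ μ f (θ, isoField M θ) = funH M μ θ σ ∧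
      ∀ i, weakGrad (state (isoField M θ) (f i)) =ᵐ[volume.restrict Ω]
        fun x => (isoField M θ x)⁻¹.toEuclideanLin (σ i x) := by
  have hp := isoField_mem_admB hm hmM h.1
  obtain ⟨τ, hτ, -, hinv, hsplit⟩ := exists_flux hd hΩb hm hp μ f
  have hJ := dualEnergy_flux hm hp (hsplit τ hτ)
  have hle : dualEnergy μ (isoField M θ) σ ≤ funJ μ f (θ, isoField M θ) := by
    rw [← hJ, ← funH_eq_dualEnergy hm h.1, ← funH_eq_dualEnergy hm h.1]
    exact h.2.2.2 τ hτ
  obtain rfl := eq_flux_of_dualEnergy_le hm hp hμ (hsplit σ h.2.1) hle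
  rw [funH_eq_dualEnergy hm h.1, hJ]
  exact ⟨rfl, hinv⟩

theorem OptCond.ae_inv_eq_isoField_inv (hm : ∀ j, 0 < minEig (M j))
    {p : (Eucl d → Fin N → ℝ) × (Eucl d → Matrix (Fin d) (Fin d) ℝ)} (hp : p ∈ admB Ω M q)
    {σ : Fin m → L2Vector Ω} (h : OptCond M p.1 p.2 σ) (i : Fin m) :
    ∀ᵐ x ∂volume.restrict Ω, (p.2 x)⁻¹.toEuclideanLin (σ i x) =
      (isoField M p.1 x)⁻¹.toEuclideanLin (σ i x) := by
  filter_upwards [h i, hp.1.2.1] with x hx ht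
  rw [hx, isoField, toEuclideanLin_inv_smul_one (lamMinus_pos hm ht).ne', one_div]

theorem funJ_congr {p p' : (Eucl d → Fin N → ℝ) × (Eucl d → Matrix (Fin d) (Fin d) ℝ)}
    (h : ∀ i, state p.2 (f i) = state p'.2 (f i)) : funJ μ f p = funJ μ f p' :=
  Finset.sum_congr rfl fun i _ => by rw [h i]

end Saddle

/-! ### The main theorem -/

theorem mainTheorem5 {d N m : ℕ} (hd : 1 ≤ d)
    (Ω : Set (Eucl d)) (hΩo : IsOpen Ω) (hΩb : Bornology.IsBounded Ω)
    (M : Fin N → Matrix (Fin d) (Fin d) ℝ) (hM : ∀ j, (M j).PosDef)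
    (q : Fin N → ℝ) (hq : ∀ j, 0 ≤ q j) (hqΩ : ∑ j, q j = volume.real Ω)
    (μ : Fin m → ℝ) (hμ : ∀ i, 0 < μ i) (f : Fin m → Hneg1 Ω) :
    -- the state equations are uniquely solvable
    (∀ p ∈ admB Ω M q, ∀ i, ∃! u : H10 Ω, IsState p.2 (f i) u) ∧
    -- the saddle points form `𝒯* × {σ*}`, with common value `H*`
    ∃ (σs : Fin m → L2Vector Ω) (Hs : ℝ),
      (saddleT M q μ f).Nonempty ∧
      {z : (Eucl d → Fin N → ℝ) × (Fin m → L2Vector Ω) | IsSaddle M q μ f z.1 z.2} =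
        saddleT M q μ f ×ˢ {σs} ∧
      (∀ θ ∈ saddleT M q μ f, funH M μ θ σs = Hs) ∧
      -- the chain of bounds for `J` on `ℬ`
      (∀ p ∈ admB Ω M q, ∀ σ : Fin m → L2Vector Ω,
        (∀ i, ∀ᵐ x ∂volume.restrict Ω,
          σ i x = (p.2 x).toEuclideanLin (weakGrad (state p.2 (f i)) x)) →
        funJ μ f p = dualEnergy μ p.2 σ ∧
        dualEnergy μ p.2 σ ≤ dualEnergy μ p.2 σs) ∧
      (∀ p ∈ admB Ω M q,
        funJ μ f p ≤ dualEnergy μ p.2 σs ∧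
        dualEnergy μ p.2 σs ≤ funH M μ p.1 σs ∧
        funH M μ p.1 σs ≤ Hs) ∧
      -- the bound `H*` is sharp
      IsLUB (funJ μ f '' admB Ω M q) Hs ∧
      (∀ θ ∈ saddleT M q μ f,
        (θ, isoField M θ) ∈ admB Ω M q ∧
        IsMaxOn (funJ μ f) (admB Ω M q) (θ, isoField M θ) ∧
        funJ μ f (θ, isoField M θ) = Hs) ∧
      -- all maximizers with first component in `𝒯*`
      (∀ θ ∈ saddleT M q μ f, ∀ A, (θ, A) ∈ admB Ω M q →
        (IsMaxOn (funJ μ f) (admB Ω M q) (θ, A) ↔ OptCond M θ A σs)) ∧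
      -- conversely, any maximizer
      (∀ θ A, (θ, A) ∈ admB Ω M q → IsMaxOn (funJ μ f) (admB Ω M q) (θ, A) →
        θ ∈ admT Ω q ∧ IsMaxOn (funI M μ f) (admT Ω q) θ ∧ OptCond M θ A σs) := by
  have hm : ∀ j, 0 < minEig (M j) := fun j => minEig_pos hd (hM j)
  have hmM : ∀ j, minEig (M j) ≤ maxEig (M j) := fun j => minEig_le_maxEig hd (hM j)
  have : IsFiniteMeasure (volume.restrict Ω) :=
    isFiniteMeasure_restrict.2 hΩb.measure_lt_top.ne
  obtain ⟨θs, σs, hs⟩ := exists_isSaddle (f := f) hd hΩb hm hmM (admT_nonempty hq hqΩ) hμ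
  have hsad : ∀ θ ∈ saddleT M q μ f, IsSaddle M q μ f θ σs := by
    rintro θ ⟨σ, h⟩
    exact h.exchange hs
  have huniq : ∀ θ σ, IsSaddle M q μ f θ σ → σ = σs := by
    intro θ σ h
    have h' := hs.exchange h
    have hp := isoField_mem_admB hm hmM hs.1
    obtain ⟨τ, hτ, -, -, hsplit⟩ := exists_flux hd hΩb hm hp μ f
    have hJ := dualEnergy_flux hm hp (hsplit τ hτ)
    -- After the exchange both fluxes are paired with the same `θs`, and each must be the flux of
    -- its isotropic field.
    have key : ∀ σ', IsSaddle M q μ f θs σ' → σ' = τ := fun σ' hσ' =>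
      eq_flux_of_dualEnergy_le hm hp hμ (hsplit σ' hσ'.2.1) (by
        rw [(hσ'.funJ_isoField hd hΩb hm hmM hμ).1, ← funH_eq_dualEnergy hm hs.1])
    rw [key σ h', key σs hs]
  set Hs := funH M μ θs σs
  have hval : ∀ θ ∈ saddleT M q μ f, funH M μ θ σs = Hs := fun θ hθ => (hsad θ hθ).funH_eq hs
  have hflux_le : ∀ p ∈ admB Ω M q, funJ μ f p ≤ dualEnergy μ p.2 σs := fun p hp => by
    obtain ⟨τ, hτ, -, -, hsplit⟩ := exists_flux hd hΩb hm hp μ f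
    rw [hsplit σs hs.2.1]
    exact le_add_of_nonneg_right (dualEnergy_nonneg hm hp hμ _)
  have hdual_le : ∀ p ∈ admB Ω M q, dualEnergy μ p.2 σs ≤ funH M μ p.1 σs := fun p hp =>
    dualEnergy_le_funH hm hmM hp hμ σs
  have hH_le : ∀ p ∈ admB Ω M q, funH M μ p.1 σs ≤ Hs := fun p hp => hs.2.2.1 _ hp.1
  have hJ_le : ∀ p ∈ admB Ω M q, funJ μ f p ≤ Hs := fun p hp =>
    (hflux_le p hp).trans ((hdual_le p hp).trans (hH_le p hp))
  have hiso : ∀ θ ∈ saddleT M q μ f, (θ, isoField M θ) ∈ admB Ω M q ∧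
      funJ μ f (θ, isoField M θ) = Hs := fun θ hθ =>
    ⟨isoField_mem_admB hm hmM (hsad θ hθ).1,
      ((hsad θ hθ).funJ_isoField hd hΩb hm hmM hμ).1.trans (hval θ hθ)⟩
  have hθs : θs ∈ saddleT M q μ f := ⟨σs, hs⟩
  have hmax_iff : ∀ p ∈ admB Ω M q, IsMaxOn (funJ μ f) (admB Ω M q) p ↔ funJ μ f p = Hs := by
    refine fun p hp => ⟨fun h => le_antisymm (hJ_le p hp) ?_, fun h p' hp' => ?_⟩
    · rw [← (hiso θs hθs).2]
      exact h (hiso θs hθs).1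
    · simpa only [Set.mem_ofPred_eq, h] using hJ_le p' hp'
  -- The value `Hs` collapses the chain of bounds to equalities.
  have hopt : ∀ p ∈ admB Ω M q, funJ μ f p = Hs → OptCond M p.1 p.2 σs := fun p hp h =>
    optCond_of_funH_le_dualEnergy hm hmM hp hμ
      ((hH_le p hp).trans (h.ge.trans (hflux_le p hp)))
  refine ⟨fun p hp i => existsUnique_isState hd hΩb hm hp (f i), σs, Hs, ⟨θs, hθs⟩, ?_, hval,
    ?_, fun p hp => ⟨hflux_le p hp, hdual_le p hp, hH_le p hp⟩, ?_, ?_, ?_, ?_⟩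
  · ext ⟨θ, σ⟩
    simp only [Set.mem_ofPred_eq, Set.mem_prod, Set.mem_singleton_iff]
    refine ⟨fun h => ⟨⟨σ, h⟩, huniq θ σ h⟩, ?_⟩
    rintro ⟨h, rfl⟩
    exact hsad θ h
  · intro p hp σ hσ
    obtain ⟨τ, hτ, hflux, -, hsplit⟩ := exists_flux hd hΩb hm hp μ f
    have : σ = τ := funext fun i => Lp.ext ((show _ =ᵐ[_] _ from hσ i).trans (hflux i).symm)
    rw [this, dualEnergy_flux hm hp (hsplit τ hτ)]
    exact ⟨rfl, hflux_le p hp⟩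
  · constructor
    · rintro _ ⟨p, hp, rfl⟩
      exact hJ_le p hp
    · intro b hb
      rw [← (hiso θs hθs).2]
      exact hb ⟨_, (hiso θs hθs).1, rfl⟩
  · intro θ hθ
    exact ⟨(hiso θ hθ).1, (hmax_iff _ (hiso θ hθ).1).2 (hiso θ hθ).2, (hiso θ hθ).2⟩
  · intro θ hθ A hA
    refine ⟨fun h => hopt (θ, A) hA ((hmax_iff (θ, A) hA).1 h), fun h => ?_⟩
    rw [hmax_iff (θ, A) hA, ← (hiso θ hθ).2]
    refine (funJ_congr fun i => ?_).symm
    refine state_eq_of_inv_flux_eq (p := (θ, isoField M θ)) (p' := (θ, A)) hd hΩb hm hA (hs.2.1 i)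
      (((hsad θ hθ).funJ_isoField hd hΩb hm hmM hμ).2 i) ?_
    filter_upwards [OptCond.ae_inv_eq_isoField_inv (p := (θ, A)) hm hA h i] with x hx using hx.symm
  · intro θ A hA h
    have hJ := (hmax_iff (θ, A) hA).1 h
    refine ⟨hA.1, ?_, hopt (θ, A) hA hJ⟩
    -- For a maximizer the collapsed chain also makes `σs` the flux of `A`. By the optimality
    -- condition the isotropic field over the same `θ` has the same states, hence the same value.
    have hI : funJ μ f (θ, isoField M θ) = Hs := by
      obtain ⟨τ, hτ, -, hinv, hsplit⟩ := exists_flux hd hΩb hm hA μ f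
      have hστ : σs = τ := eq_flux_of_dualEnergy_le (p := (θ, A)) hm hA hμ (hsplit σs hs.2.1)
        (hJ ▸ (hdual_le (θ, A) hA).trans (hH_le (θ, A) hA))
      rw [← hJ]
      refine (funJ_congr fun i => ?_).symm
      refine state_eq_of_inv_flux_eq (p := (θ, A)) (p' := (θ, isoField M θ)) hd hΩb hm
        (isoField_mem_admB hm hmM hA.1) (hτ i) (hinv i) ?_
      rw [← hστ]
      exact OptCond.ae_inv_eq_isoField_inv (p := (θ, A)) hm hA (hopt (θ, A) hA hJ) i
    intro θ' hθ'
    simp only [Set.mem_ofPred_eq, funI]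
    rw [hI]
    exact hJ_le _ (isoField_mem_admB hm hmM hθ')
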